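/- **Setting.** Let $\tau_i=-\tfrac i2\sigma_i$ ($i=1,2,3$) with $\sigma_i$ the Pauli matrices, and let $\mathcal A$ be the space of smooth $SU(2)$ connections $A=A^i_a\tau_i\,dx^a$ on $\mathbb R^3$. The Euclidean group acts on $\mathcal A$ by $$\big((x,r)\rhd A\big)^i_a(y)=r^i{}_j\,A^j_b\big(r^{-1}(y-x)\big)\,(r^{-1})^b{}_a,\qquad x\in\mathbb R^3,\ r\in SO(3).$$ Let $\mathring A\neq 0$ be a connection fixed by this action, and put $r(c):=c\mathring A$ for $c\in\mathbb R$. A *piecewise analytic path* is a map $\ell:[0,1]\to\mathbb R^3$ such that $[0,1]$ splits into finitely many closed intervals on each of which $\ell$ is real analytic up to and including the endpoints. Its holonomy is $A(\ell)=U(1)$, where $U$ is the continuous solution of $\dot U=-A(\dot\ell)\,U$, $U(0)=1$ (the equation holding off finitely many points). * $\mathrm{Cyl}$ (cylindrical functions) is the algebra of complex functions on $\mathcal A$ generated by the matrix elements $A\mapsto A(\ell)^B{}_C$, for all piecewise analytic $\ell$. * $\mathrm{Cyl}_F:=r^*[\mathrm{Cyl}]=\{c\mapsto\Phi(r(c))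 : \Phi\in\mathrm{Cyl}\}$. * $\mathrm{Cyl}_S$ is the space of finite linear combinations of the functions $c\mapsto e^{i\mu c}$, $\mu\in\mathbb R$. * $\mathscr V$ is the space of elements of $\mathrm{Cyl}_F$ that tend to $0$ as $c\to\pm\infty$. A star on a vector space denotes its algebraic dual; a star on a linear operator denotes its transpose. **Theorem.** $\mathrm{Cyl}_S\subset\mathrm{Cyl}_F$, and $\mathrm{Cyl}_F=\mathrm{Cyl}_S\oplus\mathscr V$ as vector spaces. Let $P_S:\mathrm{Cyl}_F\to\mathrm{Cyl}_S$ and $P_V:\mathrm{Cyl}_F\to\mathscr V$ be the canonical projections. The map $\mathrm{Cyl}_S^*\oplus\mathscr V^*\to\mathrm{Cyl}_F^*$, $(\psi_S,\psi_V)\mapsto\psi_S\circ P_S+\psi_V\circ P_V$, is an isomorphism; let $\iota_S:\mathrm{Cyl}_S^*\to\mathrm{Cyl}_F^*$ be its restriction to the first summand. Let $\iota_F:\mathrm{Cyl}_F^*\to\mathrm{Cyl}^*$ be given by $(\iota_F\alpha|\Phi\rangle=(\alpha|r^*\Phi\rangle$, and put $\iota:=\iota_F\circ\iota_S$. Then $\iota:\mathrm{Cyl}_S^*\to\mathrm{Cyl}^*$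 is injective and $$(\iota\psi|\Phi\rangle=(\psi|P_S\,r^*\Phi\rangle\qquad\text{for all }\psi\in\mathrm{Cyl}_S^*,\ \Phi\in\mathrm{Cyl}.$$ For $F\in\mathrm{Cyl}$ let $\widehat{F(A)}:\mathrm{Cyl}\to\mathrm{Cyl}$ be multiplication by $F$, let $\widehat{F(r(c))}:\mathrm{Cyl}_F\to\mathrm{Cyl}_F$ be multiplication by $r^*F$, and let $\widehat{F(A)}_S:=P_S\circ\widehat{F(r(c))}$, an operator on $\mathrm{Cyl}_S$. Then for every $F\in\mathrm{Cyl}$ $$\widehat{F(A)}^*\circ\iota=\iota\circ\widehat{F(A)}_S^*.$$ In particular this holds for $F(A)=A(\ell)^B{}_C$, for every (possibly curved) piecewise analytic path $\ell$ and all $B,C$. -/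

import Mathlib

open scoped ContDiff

namespace LQC

noncomputable section

/-- Flat physical space. -/
abbrev Space : Type := EuclideanSpace ℝ (Fin 3)

/-! ### `SU(2)` connections -/

/-- The basis `τ_i = -(i/2) σ_i` of `su(2)`, with `σ_i` the Pauli matrices. -/
def tau : Fin 3 → Matrix (Fin 2) (Fin 2) ℂ :=
  ![(-Complex.I / 2) • !![0, 1; 1, 0],
    (-Complex.I / 2) • !![0, -Complex.I; Complex.I, 0],
    (-Complex.I / 2) • !![1, 0; 0, -1]]

/-- A smooth `SU(2)` connection `A = A^i_a τ_i dx^a` on the (trivial) bundle over `ℝ³`,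
given by its components; `comp i a x` is `A^i_a(x)`. -/
@[ext]
structure Connection where
  comp : Fin 3 → Fin 3 → Space → ℝ
  smooth : ∀ i a, ContDiff ℝ ∞ (comp i a)

/-- Rescaling of a connection, `c ↦ c A`. -/
instance : SMul ℝ Connection where
  smul c A :=
    { comp := fun i a x => c * A.comp i a x
      smooth := fun i a => contDiff_const.mul (A.smooth i a) }

/-- The action of the Euclidean motion `φ(y) = r y + x` on connections: the push-forward of
the one-forms `A^j` by `φ`, followed by the rotation `r^i_j` of the internal index,
`((x,r) ▷ A)^i_a(y) = r^i_j A^j_b(r⁻¹(y - x)) (r⁻¹)^b_a`, where `r⁻¹ = rᵀ`. -/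
def euclideanAct (x : Space) (r : Matrix.specialOrthogonalGroup (Fin 3) ℝ)
    (A : Connection) : Connection where
  comp i a y := ∑ j, ∑ b, (r : Matrix (Fin 3) (Fin 3) ℝ) i j *
    A.comp j b (Matrix.toEuclideanCLM (𝕜 := ℝ) (r : Matrix (Fin 3) (Fin 3) ℝ).transpose (y - x)) *
    (r : Matrix (Fin 3) (Fin 3) ℝ).transpose b a
  smooth i a := by
    refine ContDiff.sum fun j _ => ContDiff.sum fun b _ => ?_
    refine (contDiff_const.mul ((A.smooth j b).comp ?_)).mul contDiff_const
    exact (ContinuousLinearMap.contDiff _).comp (contDiff_id.sub contDiff_const)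

/-- `𝒜_S`: the homogeneous isotropic connections, those fixed by every Euclidean motion. -/
def symmetricConnections : Set Connection :=
  {A | ∀ x r, euclideanAct x r A = A}

/-! ### Piecewise analytic paths and holonomies -/

/-- `γ`, restricted to `[0,1]`, is a piecewise analytic path: `[0,1]` splits into finitely many
closed intervals, on each of which `γ` is real analytic up to and including the endpoints
(so `γ` is continuous on `[0,1]`). -/
def IsPiecewiseAnalytic (γ : ℝ → Space) : Prop :=
  ∃ (n : ℕ) (p : Fin (n + 1) → ℝ), StrictMono p ∧ p 0 = 0 ∧ p (Fin.last n) = 1 ∧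
    ∀ k : Fin n, AnalyticOn ℝ γ (Set.Icc (p k.castSucc) (p k.succ))

/-- The value `A(γ̇(t)) = γ̇^a(t) A^i_a(γ(t)) τ_i` of a connection on the velocity of `γ`. -/
def Connection.onVelocity (A : Connection) (γ : ℝ → Space) (t : ℝ) : Matrix (Fin 2) (Fin 2) ℂ :=
  ∑ i, ∑ a, ((deriv γ t a * A.comp i a (γ t) : ℝ) : ℂ) • tau i

/-- `g` is the parallel transport of `A` along `γ`: `g = U(1)` for the continuous solution of
`U' = -A(γ̇) U`, `U(0) = 1`, where the equation holds off the finitely many breakpoints. -/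
def IsHolonomy (A : Connection) (γ : ℝ → Space) (g : Matrix (Fin 2) (Fin 2) ℂ) : Prop :=
  ∃ U : ℝ → Matrix (Fin 2) (Fin 2) ℂ,
    ContinuousOn U (Set.Icc 0 1) ∧ U 0 = 1 ∧ U 1 = g ∧
    ∃ S : Finset ℝ, ∀ t ∈ Set.Ioo (0 : ℝ) 1, t ∉ S → ∀ B C : Fin 2,
      HasDerivAt (fun s => U s B C) ((-(A.onVelocity γ t) * U t) B C) t

/-- The holonomy `A(γ)`: the unique `g` with `IsHolonomy A γ g`. -/
def holonomy (A : Connection) (γ : ℝ → Space) : Matrix (Fin 2) (Fin 2) ℂ :=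
  Classical.epsilon (IsHolonomy A γ)

/-! ### Test states -/

/-- `Cyl`: the cylindrical functions, i.e. the algebra of functions of the connection generated
by the matrix elements of the holonomies along all piecewise analytic paths. -/
def Cyl : Subalgebra ℂ (Connection → ℂ) :=
  Algebra.adjoin ℂ {f | ∃ γ : ℝ → Space, IsPiecewiseAnalytic γ ∧
    ∃ B C : Fin 2, f = fun A => holonomy A γ B C}

/-- The cylindrical function `A ↦ A(γ)^B_C`. -/
def holonomyElement (γ : ℝ → Space) (hγ : IsPiecewiseAnalytic γ) (B C : Fin 2) : Cyl :=
  ⟨fun A => holonomy A γ B C, Algebra.subset_adjoin ⟨γ, hγ, B, C, rfl⟩⟩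

/-- `Cyl_S`: the finite linear combinations of the exponentials `c ↦ e^{iμc}`, `μ ∈ ℝ`. -/
def CylS : Submodule ℂ (ℝ → ℂ) :=
  Submodule.span ℂ (Set.range fun μ : ℝ => fun c : ℝ => Complex.exp (Complex.I * μ * c))

/-- Pull-back `r^*` of functions along `r : ℝ → 𝒜`, `r(c) = c A₀`. -/
def pullback (A₀ : Connection) : (Connection → ℂ) →ₐ[ℂ] (ℝ → ℂ) where
  toFun Φ c := Φ (c • A₀)
  map_one' := rfl
  map_mul' _ _ := rfl
  map_zero' := rfl
  map_add' _ _ := rfl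
  commutes' _ := rfl

/-- `Cyl_F = r^*[Cyl]`. -/
def CylF (A₀ : Connection) : Subalgebra ℂ (ℝ → ℂ) := Cyl.map (pullback A₀)

/-- `r^* : Cyl → Cyl_F`. -/
def rStar (A₀ : Connection) : Cyl →ₗ[ℂ] CylF A₀ where
  toFun Φ := ⟨pullback A₀ Φ, Φ, Φ.2, rfl⟩
  map_add' _ _ := rfl
  map_smul' _ _ := rfl

/-- `𝒱`: the elements of `Cyl_F` that vanish at `±∞`. -/
def CylV (A₀ : Connection) : Submodule ℂ (CylF A₀) where
  carrier := {f | Filter.Tendsto (f : ℝ → ℂ) (Filter.cocompact ℝ) (nhds 0)}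
  add_mem' {f g} hf hg := by
    have h := Filter.Tendsto.add hf hg
    rw [add_zero] at h
    exact h
  zero_mem' := tendsto_const_nhds
  smul_mem' z f hf := by
    have h := Filter.Tendsto.const_smul hf z
    rw [smul_zero] at h
    exact h

/-- `Cyl_F = Cyl_S ⊕ 𝒱` as vector spaces. -/
def Decomposes (A₀ : Connection) : Prop :=
  ∃ _ : CylS ≤ (CylF A₀).toSubmodule,
    IsCompl (CylS.comap (CylF A₀).toSubmodule.subtype) (CylV A₀)

variable {A₀ : Connection}

/-- The inclusion of `Cyl_S` into `Cyl_F`. -/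
def inclS (h : Decomposes A₀) : CylS →ₗ[ℂ] CylF A₀ :=
  Submodule.inclusion h.1

/-- The canonical projection `P_S : Cyl_F → Cyl_S` along `𝒱`. -/
def projS (h : Decomposes A₀) : CylF A₀ →ₗ[ℂ] CylS :=
  (Submodule.comapSubtypeEquivOfLe h.1).toLinearMap ∘ₗ
    Submodule.projectionOnto _ _ h.2

/-- The canonical projection `P_V : Cyl_F → 𝒱` along `Cyl_S`. -/
def projV (h : Decomposes A₀) : CylF A₀ →ₗ[ℂ] CylV A₀ :=
  Submodule.projectionOnto _ _ h.2.symm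

/-! ### Distributional states and the embedding -/

/-- `ι_F : Cyl_F^* → Cyl^*`, `(ι_F α | Φ⟩ = (α | r^* Φ⟩`. -/
def iotaF (A₀ : Connection) : Module.Dual ℂ (CylF A₀) →ₗ[ℂ] Module.Dual ℂ Cyl :=
  (rStar A₀).dualMap

/-- The map `Cyl_S^* ⊕ 𝒱^* → Cyl_F^*`, `(ψ_S, ψ_V) ↦ ψ_S ∘ P_S + ψ_V ∘ P_V`. -/
def dualSum (h : Decomposes A₀) :
    (Module.Dual ℂ CylS × Module.Dual ℂ (CylV A₀)) →ₗ[ℂ] Module.Dual ℂ (CylF A₀) :=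
  (projS h).dualMap.coprod (projV h).dualMap

/-- `ι_S : Cyl_S^* → Cyl_F^*`, the inclusion of the first summand of `Cyl_S^* ⊕ 𝒱^*`. -/
def iotaS (h : Decomposes A₀) : Module.Dual ℂ CylS →ₗ[ℂ] Module.Dual ℂ (CylF A₀) :=
  dualSum h ∘ₗ LinearMap.inl ℂ _ _

/-- `ι = ι_F ∘ ι_S`. -/
def iota (h : Decomposes A₀) : Module.Dual ℂ CylS →ₗ[ℂ] Module.Dual ℂ Cyl :=
  iotaF A₀ ∘ₗ iotaS h

/-! ### Operators -/

/-- The operator of a cylindrical function `F(A)` in the full theory: multiplication on `Cyl`. -/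
def opFull (F : Cyl) : Cyl →ₗ[ℂ] Cyl := LinearMap.mulLeft ℂ F

/-- The operator of `F(r(c))`: multiplication on `Cyl_F`. -/
def opF (A₀ : Connection) (F : Cyl) : CylF A₀ →ₗ[ℂ] CylF A₀ :=
  LinearMap.mulLeft ℂ (rStar A₀ F)

/-- The reduced operator of `F(A)` on `Cyl_S`: `P_S` after multiplication by `F(r(c))`. -/
def opS (h : Decomposes A₀) (F : Cyl) : CylS →ₗ[ℂ] CylS :=
  projS h ∘ₗ opF A₀ F ∘ₗ inclS h

end

end LQC

/-!
By the classification of the homogeneous isotropic connections, `A₀ = p δ^i_a τ_i dx^a` with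
`p ≠ 0` (`exists_comp_eq_of_mem_symmetricConnections`). The holonomy of `c A₀` along a path with
velocity `u` is the transport of `(i θ / 2) u · σ` with `θ = p c`. The heart of the matter is that
its matrix elements are, as functions of `c`, trigonometric polynomials up to functions vanishing
at `±∞` (`holonomy_smul_mem_asympTrig`).

Near a point `t₀` a nonzero analytic velocity is `u = ρ n`, where `n` is a smooth field of unit
vectors and `ρ` vanishes at most at `t₀`. Large `θ` is then an adiabatic regime for the involution
`N = n · σ` (`exists_tendsto_transport_sub_rot`): the transport `V` of `½ N' N` carries the
eigenspaces of `N` along, and in the frame of `V`, with the dynamical phase `θ Φ`, `Φ = ½ ∫ ρ`,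
removed, the transport solves an equation whose coefficient oscillates like `exp (± 2 i θ Φ)`. By
the Riemann–Lebesgue lemma in the variable `Φ` (`tendsto_integral_exp_phase`) and one integration by
parts (`tendsto_one_of_tendsto_primitive`) its solution tends to `1`. So the transport is
asymptotic to `V exp (i θ Φ N)`, whose frequencies do not depend on `θ`. Products of such transports
are of the same kind, and continuous induction (`rel_of_local_rel`) reaches the whole path.

The functions asymptotic to trigonometric polynomials form an algebra, so all of `Cyl_F` consists of
them. Straight segments give every exponential (`CylS_le_CylF`), and a trigonometric polynomial
vanishing at infinity is zero (`eq_zero_of_mem_CylS_of_tendsto`): this is the direct sum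
`Cyl_F = Cyl_S ⊕ 𝒱`. The elements of `Cyl_F` are bounded near infinity, so `𝒱` is an ideal of
`Cyl_F` (`mul_mem_CylV`), whence `P_S (r^*F · r^*Φ) = P_S (r^*F · P_S r^*Φ)`, which is the
intertwining relation.
-/

namespace LQC

open Filter Topology Set MeasureTheory

noncomputable section

/-! ### Continuous induction -/

/-- Continuous induction for a transitive relation between the points of an interval. -/
theorem rel_of_local_rel {P : ℝ → ℝ → Prop} {a b : ℝ} (hab : a < b)
    (trans : ∀ x y z, x < y → y < z → P x y → P y z → P x z)
    (right : ∀ t ∈ Ico a b, ∀ᶠ s in 𝓝[>] t, P t s)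
    (left : ∀ t ∈ Ioc a b, ∀ᶠ s in 𝓝[<] t, P s t) : P a b := by
  set S : Set ℝ := {t | a < t ∧ t ≤ b ∧ P a t} with hS
  have hne : S.Nonempty := by
    obtain ⟨t, ht, htP⟩ :=
      ((Ioo_mem_nhdsGT hab : Ioo a b ∈ 𝓝[>] a) |> fun h =>
        (Filter.eventually_of_mem h fun x hx => hx).and (right a ⟨le_rfl, hab⟩)).exists
    exact ⟨t, ht.1, ht.2.le, htP⟩
  have hbdd : BddAbove S := ⟨b, fun t ht => ht.2.1⟩
  set m := sSup S with hm
  have ham : a < m := by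
    obtain ⟨t, ht⟩ := hne
    exact ht.1.trans_le (le_csSup hbdd ht)
  have hmb : m ≤ b := csSup_le hne fun t ht => ht.2.1
  have hPm : P a m := by
    obtain ⟨l, hl, hlP⟩ := (mem_nhdsLT_iff_exists_Ioo_subset.1 (left m ⟨ham, hmb⟩))
    obtain ⟨t, ht, hlt⟩ := exists_lt_of_lt_csSup hne hl
    rcases (le_csSup hbdd ht).eq_or_lt with h | h
    · rw [hm, ← h]; exact ht.2.2
    · exact trans _ _ _ ht.1 h ht.2.2 (hlP ⟨hlt, h⟩)
  rcases hmb.eq_or_lt with h | h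
  · rwa [← h]
  · obtain ⟨t, ht, htP⟩ :=
      ((Ioo_mem_nhdsGT h : Ioo m b ∈ 𝓝[>] m) |> fun h' =>
        (Filter.eventually_of_mem h' fun x hx => hx).and (right m ⟨ham.le, h⟩)).exists
    exact absurd (le_csSup hbdd ⟨ham.trans ht.1, ht.2.le, trans _ _ _ ham ht.1 hPm htP⟩)
      (not_le.2 ht.1)

/-! ### Linear differential equations in a C⋆-algebra -/

section CStar

variable {𝔸 : Type*} [CStarAlgebra 𝔸]

/-- `g` is the value at `b` of a continuous solution of `U' = A U`, `U(a) = 1` on `[a, b]`, the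
equation being required off a finite set. -/
def IsTransport (A : ℝ → 𝔸) (a b : ℝ) (g : 𝔸) : Prop :=
  ∃ U : ℝ → 𝔸, ContinuousOn U (Icc a b) ∧ U a = 1 ∧ U b = g ∧
    ∃ S : Finset ℝ, ∀ t ∈ Ioo a b, t ∉ S → HasDerivAt U (A t * U t) t

theorem IsTransport.congr {A A' : ℝ → 𝔸} {a b : ℝ} {g : 𝔸} (h : IsTransport A a b g)
    (hA : EqOn A A' (Ioo a b)) : IsTransport A' a b g := by
  obtain ⟨U, hc, h0, h1, S, hS⟩ := h
  exact ⟨U, hc, h0, h1, S, fun t ht htS => hA ht ▸ hS t ht htS⟩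

theorem IsTransport.trans {A : ℝ → 𝔸} {a b c : ℝ} (hab : a < b) (hbc : b < c) {g g' : 𝔸}
    (h : IsTransport A a b g) (h' : IsTransport A b c g') : IsTransport A a c (g' * g) := by
  classical
  obtain ⟨U, hc, h0, h1, S, hS⟩ := h
  obtain ⟨U', hc', h0', h1', S', hS'⟩ := h'
  set W : ℝ → 𝔸 := fun t => if t ≤ b then U t else U' t * g with hW
  have hW1 : EqOn W U (Icc a b) := fun t ht => if_pos ht.2
  have hW2 : EqOn W (fun t => U' t * g) (Icc b c) := by
    intro t ht
    rcases ht.1.eq_or_lt with h | h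
    · subst h; simp [hW, h0', h1]
    · exact if_neg (not_le.2 h)
  refine ⟨W, ?_, ?_, ?_, insert b (S ∪ S'), ?_⟩
  · rw [← Icc_union_Icc_eq_Icc hab.le hbc.le]
    exact (hc.congr hW1).union_of_isClosed ((hc'.mul continuousOn_const).congr hW2)
      isClosed_Icc isClosed_Icc
  · rw [hW1 ⟨le_rfl, hab.le⟩, h0]
  · rw [hW2 ⟨hbc.le, le_rfl⟩]; simp [h1']
  · intro t ht htS
    simp only [Finset.mem_insert, Finset.mem_union, not_or] at htS
    rcases lt_or_gt_of_ne htS.1 with h | h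
    · have h2 := hS t ⟨ht.1, h⟩ htS.2.1
      rw [hW1 ⟨ht.1.le, h.le⟩]
      exact h2.congr_of_eventuallyEq (hW1.eventuallyEq_of_mem (Icc_mem_nhds ht.1 h))
    · have h2 := (hS' t ⟨h, ht.2⟩ htS.2.2).mul_const g
      rw [hW2 ⟨h.le, ht.2.le⟩, ← mul_assoc]
      exact h2.congr_of_eventuallyEq (hW2.eventuallyEq_of_mem (Icc_mem_nhds h ht.2))

/-- Picard–Lindelöf on an interval which is short in terms of a local bound of the coefficient. -/
theorem exists_isTransport_near {A : ℝ → 𝔸} (hA : Continuous A) (t₀ : ℝ) :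
    ∃ ε > 0, ∀ s ∈ Ioo (t₀ - ε) (t₀ + ε), ∀ t ∈ Ioo (t₀ - ε) (t₀ + ε), s < t →
      ∃ g, IsTransport A s t g := by
  obtain ⟨δ, hδ, hδA⟩ := Metric.continuousAt_iff.1 (hA.continuousAt (x := t₀)) 1 one_pos
  set M : NNReal := ‖A t₀‖₊ + 1 with hM
  have hAM : ∀ t ∈ Ioo (t₀ - δ) (t₀ + δ), ‖A t‖ ≤ M := by
    intro t ht
    have h1 : dist (A t) (A t₀) < 1 := hδA (by
      rw [Real.dist_eq, abs_lt]
      constructor <;> linarith [ht.1, ht.2])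
    have h2 : ‖A t‖ ≤ ‖A t₀‖ + ‖A t - A t₀‖ := by
      simpa using norm_add_le (A t₀) (A t - A t₀)
    rw [dist_eq_norm] at h1
    simp only [hM, NNReal.coe_add, coe_nnnorm, NNReal.coe_one]
    linarith
  set L : NNReal := M * (‖(1 : 𝔸)‖₊ + 1) with hL
  have hLpos : 0 < (L : ℝ) := by rw [hL, hM]; push_cast; positivity
  refine ⟨min δ (1 / (2 * L)), by positivity, fun s hs t ht hst => ?_⟩
  have hmin1 := min_le_left δ (1 / (2 * (L : ℝ)))
  have hmin2 := min_le_right δ (1 / (2 * (L : ℝ)))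
  have hsub : Icc s t ⊆ Ioo (t₀ - δ) (t₀ + δ) := fun x hx =>
    ⟨by linarith [hx.1, hs.1], by linarith [hx.2, ht.2]⟩
  have hPL : IsPicardLindelof (fun τ x => A τ * x) (⟨s, le_rfl, hst.le⟩ : Icc s t) (1 : 𝔸)
      1 0 L M := by
    refine ⟨fun τ hτ => ?_, fun x _ => (hA.mul continuous_const).continuousOn, fun τ hτ x hx => ?_,
      ?_⟩
    · refine LipschitzOnWith.of_dist_le_mul fun x _ y _ => ?_
      rw [dist_eq_norm, ← mul_sub, dist_eq_norm]
      exact (norm_mul_le _ _).trans (mul_le_mul_of_nonneg_right (hAM τ (hsub hτ)) (norm_nonneg _))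
    · have hx' : ‖x‖ ≤ ‖(1 : 𝔸)‖ + 1 := by
        have := mem_closedBall_iff_norm.1 hx
        have h3 : ‖x‖ ≤ ‖(1 : 𝔸)‖ + ‖x - 1‖ := by simpa using norm_add_le (1 : 𝔸) (x - 1)
        simp only [NNReal.coe_one] at this
        linarith
      rw [hL]
      push_cast
      exact (norm_mul_le _ _).trans
        (mul_le_mul (hAM τ (hsub hτ)) hx' (norm_nonneg _) (by positivity))
    · simp only [sub_self, NNReal.coe_one, NNReal.coe_zero, sub_zero]
      rw [max_eq_left (by linarith)]
      have : t - s ≤ 1 / (L : ℝ) := by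
        have : 1 / (L : ℝ) = 2 * (1 / (2 * L)) := by field_simp
        linarith [hs.1, ht.2]
      calc (L : ℝ) * (t - s) ≤ L * (1 / L) := by gcongr
        _ = 1 := by field_simp
  obtain ⟨U, hU0, hU⟩ := hPL.exists_eq_forall_mem_Icc_hasDerivWithinAt₀
  exact ⟨U t, U, fun τ hτ => (hU τ hτ).continuousWithinAt, hU0, rfl, ∅, fun τ hτ _ =>
    (hU τ ⟨hτ.1.le, hτ.2.le⟩).hasDerivAt (Icc_mem_nhds hτ.1 hτ.2)⟩

theorem exists_isTransport {A : ℝ → 𝔸} {a b : ℝ} (hab : a < b) (hA : ContinuousOn A (Icc a b)) :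
    ∃ g, IsTransport A a b g := by
  have key : ∃ g, IsTransport (IccExtend hab.le ((Icc a b).domRestrict A)) a b g := by
    have hc : Continuous (IccExtend hab.le ((Icc a b).domRestrict A)) :=
      (continuousOn_iff_continuous_domRestrict.1 hA).Icc_extend'
    refine rel_of_local_rel (P := fun s t => ∃ g, IsTransport _ s t g) hab ?_ ?_ ?_
    · rintro x y z hxy hyz ⟨g, hg⟩ ⟨g', hg'⟩
      exact ⟨_, hg.trans hxy hyz hg'⟩
    · intro t _
      obtain ⟨ε, hε, h⟩ := exists_isTransport_near hc t
      filter_upwards [Ioo_mem_nhdsGT (show t < t + ε by linarith)] with s hs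
      exact h t ⟨by linarith, by linarith⟩ s ⟨by linarith [hs.1], hs.2⟩ hs.1
    · intro t _
      obtain ⟨ε, hε, h⟩ := exists_isTransport_near hc t
      filter_upwards [Ioo_mem_nhdsLT (show t - ε < t by linarith)] with s hs
      exact h s ⟨hs.1, by linarith [hs.2]⟩ t ⟨by linarith, by linarith⟩ hs.2
  obtain ⟨g, hg⟩ := key
  exact ⟨g, hg.congr fun t ht => IccExtend_of_mem hab.le _ ⟨ht.1.le, ht.2.le⟩⟩

theorem eq_of_hasDerivAt_zero_off_finite {E : Type*} [NormedAddCommGroup E] [NormedSpace ℝ E]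
    [CompleteSpace E] {f : ℝ → E} {a b : ℝ} (hc : ContinuousOn f (Icc a b)) (S : Finset ℝ)
    (hf : ∀ t ∈ Ioo a b, t ∉ S → HasDerivAt f 0 t) {t : ℝ} (ht : t ∈ Icc a b) : f t = f a := by
  have h := integral_eq_of_hasDerivAt_off_countable_of_le f (fun _ => 0) ht.1
    S.countable_toSet (hc.mono (Icc_subset_Icc_right ht.2))
    (fun x hx => hf x ⟨hx.1.1, hx.1.2.trans_le ht.2⟩ (by simpa using hx.2)) (by simp)
  simpa [sub_eq_zero, eq_comm] using h

/-- Two solutions of `U' = K U` with skew-adjoint `K` have a constant product `U* V`. -/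
theorem star_mul_eq_of_hasDerivAt {K U V : ℝ → 𝔸} {a b : ℝ}
    (hK : ∀ t ∈ Ioo a b, star (K t) = -K t)
    (hUc : ContinuousOn U (Icc a b)) (hVc : ContinuousOn V (Icc a b)) (S : Finset ℝ)
    (hU : ∀ t ∈ Ioo a b, t ∉ S → HasDerivAt U (K t * U t) t)
    (hV : ∀ t ∈ Ioo a b, t ∉ S → HasDerivAt V (K t * V t) t) {t : ℝ} (ht : t ∈ Icc a b) :
    star (U t) * V t = star (U a) * V a := by
  refine eq_of_hasDerivAt_zero_off_finite (f := fun t => star (U t) * V t)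
    (hUc.star.mul hVc) S (fun s hs hsS => ?_) ht
  convert! (hU s hs hsS).star.mul (hV s hs hsS) using 1
  rw [star_mul, hK s hs]
  noncomm_ring

/-- Both solutions are unitary, and the product `U* V` keeps its initial value `1`. -/
theorem IsTransport.unique [IsDedekindFiniteMonoid 𝔸] {A : ℝ → 𝔸} {a b : ℝ} (hab : a ≤ b)
    (hA : ∀ t ∈ Ioo a b, star (A t) = -A t) {g g' : 𝔸} (h : IsTransport A a b g)
    (h' : IsTransport A a b g') : g = g' := by
  classical
  obtain ⟨U, hc, h0, rfl, S, hS⟩ := h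
  obtain ⟨V, hc', h0', rfl, S', hS'⟩ := h'
  have hU := star_mul_eq_of_hasDerivAt hA hc hc S hS hS ⟨hab, le_rfl⟩
  have hUV := star_mul_eq_of_hasDerivAt hA hc hc' (S ∪ S')
    (fun t ht hts => hS t ht (by simp_all)) (fun t ht hts => hS' t ht (by simp_all)) ⟨hab, le_rfl⟩
  rw [h0, star_one, one_mul] at hU
  rw [h0, h0', star_one, one_mul] at hUV
  have hU' : U b * star (U b) = 1 := mul_eq_one_symm hU
  calc U b = U b * (star (U b) * V b) := by rw [hUV, mul_one]
    _ = V b := by rw [← mul_assoc, hU', one_mul]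

/-! ### Oscillatory coefficients -/

/-- Riemann–Lebesgue lemma for a phase with nowhere vanishing derivative. No regularity of the
amplitude is needed, since both the change of variables and the classical lemma hold
unconditionally with the convention that the integral of a non-integrable function is zero. -/
theorem tendsto_integral_exp_phase {E : Type*} [NormedAddCommGroup E] [NormedSpace ℂ E]
    {Φ φ : ℝ → ℝ} {a b : ℝ} (hΦ : ∀ t ∈ Ioo a b, HasDerivAt Φ (φ t) t)
    (hφ : ∀ t ∈ Ioo a b, φ t ≠ 0) (m : ℝ → E) :
    Tendsto (fun θ : ℝ => ∫ s in Ioo a b, Complex.exp (Complex.I * (θ * Φ s : ℝ)) • m s)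
      (cocompact ℝ) (𝓝 0) := by
  have hcont : ContinuousOn Φ (Ioo a b) := fun t ht => (hΦ t ht).continuousAt.continuousWithinAt
  have hinj : InjOn Φ (Ioo a b) := by
    have key : ∀ x ∈ Ioo a b, ∀ y ∈ Ioo a b, x < y → Φ x ≠ Φ y := by
      intro x hx y hy hxy h
      obtain ⟨z, hz, hz0⟩ := exists_hasDerivAt_eq_zero (f' := φ) hxy
        (hcont.mono (Icc_subset_Ioo hx.1 hy.2)) h
        (fun z hz => hΦ z ⟨hx.1.trans hz.1, hz.2.trans hy.2⟩)
      exact hφ z ⟨hx.1.trans hz.1, hz.2.trans hy.2⟩ hz0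
    intro x hx y hy h
    by_contra hne
    rcases lt_or_gt_of_ne hne with h' | h'
    · exact key x hx y hy h' h
    · exact key y hy x hx h' h.symm
  have hmeas : MeasurableSet (Φ '' Ioo a b) :=
    (isPreconnected_Ioo.image _ hcont).ordConnected.measurableSet
  set Ψ := Function.invFunOn Φ (Ioo a b) with hΨ
  set f : ℝ → E := (Φ '' Ioo a b).indicator fun y => |φ (Ψ y)|⁻¹ • m (Ψ y) with hf
  have hRL := Real.tendsto_integral_exp_smul_cocompact f
  have hscale : Tendsto (fun θ : ℝ => -θ / (2 * Real.pi)) (cocompact ℝ) (cocompact ℝ) := by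
    have h2 : (-(2 * Real.pi)⁻¹ : ℝ) ≠ 0 := by simp [Real.pi_ne_zero]
    convert! (Homeomorph.mulLeft₀ _ h2).isClosedEmbedding.tendsto_cocompact using 2 with θ
    simp [div_eq_mul_inv, mul_comm]
  refine (hRL.comp hscale).congr fun θ => ?_
  have h1 : (fun v => Real.fourierChar (-(v * (-θ / (2 * Real.pi)))) • f v) =
      (Φ '' Ioo a b).indicator fun y =>
        Complex.exp (Complex.I * (θ * y : ℝ)) • |φ (Ψ y)|⁻¹ • m (Ψ y) := by
    funext v
    by_cases hv : v ∈ Φ '' Ioo a b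
    · rw [indicator_of_mem hv, hf, indicator_of_mem hv, Circle.smul_def, Real.fourierChar_apply]
      congr 2
      push_cast
      field_simp
    · rw [indicator_of_notMem hv, hf, indicator_of_notMem hv, smul_zero]
  rw [Function.comp_apply, h1, integral_indicator hmeas, integral_image_eq_integral_abs_deriv_smul
    measurableSet_Ioo (fun x hx => (hΦ x hx).hasDerivWithinAt) hinj]
  refine setIntegral_congr_fun measurableSet_Ioo fun s hs => ?_
  have hs' : Ψ (Φ s) = s := hinj.leftInvOn_invFunOn hs
  have hpos : |φ s| ≠ 0 := abs_ne_zero.2 (hφ s hs)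
  simp only [hs']
  rw [smul_comm, smul_smul, mul_inv_cancel₀ hpos, one_smul]

/-- If the primitives of the coefficients `D θ` of bounded solutions of `Z' = (D θ) Z` tend to zero
pointwise, then the solutions tend to their initial value: integrate by parts once. -/
theorem tendsto_one_of_tendsto_primitive {D Z : ℝ → ℝ → 𝔸} {a b C : ℝ} (hab : a < b)
    (hD : ∀ θ, ContinuousOn (D θ) (Icc a b)) (hDC : ∀ θ, ∀ t ∈ Icc a b, ‖D θ t‖ ≤ C)
    (hZc : ∀ θ, ContinuousOn (Z θ) (Icc a b)) (hZ0 : ∀ θ, Z θ a = 1)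
    (hZC : ∀ θ, ∀ t ∈ Icc a b, ‖Z θ t‖ ≤ C)
    (hZ : ∀ θ, ∃ S : Finset ℝ, ∀ t ∈ Ioo a b, t ∉ S → HasDerivAt (Z θ) (D θ t * Z θ t) t)
    (hB : ∀ t ∈ Icc a b, Tendsto (fun θ => ∫ s in a..t, D θ s) (cocompact ℝ) (𝓝 0)) :
    Tendsto (fun θ => Z θ b) (cocompact ℝ) (𝓝 1) := by
  have haI : a ∈ Icc a b := ⟨le_rfl, hab.le⟩
  have hbI : b ∈ Icc a b := ⟨hab.le, le_rfl⟩
  have hC : 0 ≤ C := (norm_nonneg _).trans (hDC 0 a haI)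
  set B : ℝ → ℝ → 𝔸 := fun θ t => ∫ s in a..t, D θ s with hBdef
  have hDi : ∀ θ, ∀ t ∈ Icc a b, IntervalIntegrable (D θ) volume a t := fun θ t ht =>
    ((hD θ).mono (by rw [uIcc_of_le ht.1]; exact Icc_subset_Icc_right ht.2)).intervalIntegrable
  have hBd : ∀ θ, ∀ t ∈ Ioo a b, HasDerivAt (B θ) (D θ t) t := fun θ t ht =>
    intervalIntegral.integral_hasDerivAt_right (hDi θ t ⟨ht.1.le, ht.2.le⟩)
      ((hD θ).mono Ioo_subset_Icc_self |>.stronglyMeasurableAtFilter isOpen_Ioo t ht)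
      ((hD θ).continuousAt (Icc_mem_nhds ht.1 ht.2))
  have hBc : ∀ θ, ContinuousOn (B θ) (Icc a b) := fun θ => by
    have := intervalIntegral.continuousOn_primitive_interval' (hDi θ b hbI) left_mem_uIcc
    rwa [uIcc_of_le hab.le] at this
  have hBC : ∀ θ, ∀ t ∈ Icc a b, ‖B θ t‖ ≤ C * (b - a) := by
    intro θ t ht
    refine (intervalIntegral.norm_integral_le_of_norm_le_const (C := C) fun x hx => ?_).trans ?_
    · rw [uIoc_of_le ht.1] at hx
      exact hDC θ x ⟨hx.1.le, hx.2.trans ht.2⟩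
    · rw [abs_of_nonneg (by linarith [ht.1])]
      gcongr
      exact ht.2
  -- `Z - B Z` has the derivative `-B D Z`, in which only the small primitive `B` is left.
  have hformula : ∀ θ, Z θ b = 1 + B θ b * Z θ b - ∫ t in a..b, B θ t * D θ t * Z θ t := by
    intro θ
    obtain ⟨S, hS⟩ := hZ θ
    have hint : ContinuousOn (fun t => -(B θ t * D θ t * Z θ t)) (Icc a b) :=
      (((hBc θ).mul (hD θ)).mul (hZc θ)).neg
    have h := integral_eq_of_hasDerivAt_off_countable_of_le
      (fun t => Z θ t - B θ t * Z θ t) (fun t => -(B θ t * D θ t * Z θ t)) hab.le S.countable_toSet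
      ((hZc θ).sub ((hBc θ).mul (hZc θ))) (fun t ht => by
        have h1 := hS t ht.1 (by simpa using ht.2)
        convert! h1.sub ((hBd θ t ht.1).mul h1) using 1
        noncomm_ring)
      (hint.intervalIntegrable_of_Icc hab.le)
    rw [intervalIntegral.integral_neg] at h
    have hBa : B θ a = 0 := intervalIntegral.integral_same
    rw [hBa, hZ0, zero_mul, sub_zero] at h
    rw [sub_eq_add_neg, h]
    abel
  have h1 : Tendsto (fun θ => B θ b * Z θ b) (cocompact ℝ) (𝓝 0) := by
    refine squeeze_zero_norm (a := fun θ => ‖B θ b‖ * C) (fun θ => (norm_mul_le _ _).trans ?_) ?_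
    · gcongr
      exact hZC θ b hbI
    · simpa using (hB b hbI).norm.mul_const C
  have h2 : Tendsto (fun θ => ∫ t in a..b, B θ t * D θ t * Z θ t) (cocompact ℝ) (𝓝 0) := by
    have : IsCountablyGenerated (cocompact ℝ) := by
      rw [cocompact_eq_atBot_atTop]; infer_instance
    have := intervalIntegral.tendsto_integral_filter_of_dominated_convergence
      (μ := volume) (a := a) (b := b) (l := cocompact ℝ)
      (F := fun θ t => B θ t * D θ t * Z θ t) (f := fun _ => 0)
      (fun _ => C * (b - a) * C * C) ?_ ?_ (by simp) ?_
    · simpa using this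
    · refine Eventually.of_forall fun θ => ?_
      rw [uIoc_of_le hab.le]
      exact (((((hBc θ).mul (hD θ)).mul (hZc θ)).mono
        Ioc_subset_Icc_self).aestronglyMeasurable measurableSet_Ioc)
    · refine Eventually.of_forall fun θ => Eventually.of_forall fun t ht => ?_
      rw [uIoc_of_le hab.le] at ht
      have ht' := Ioc_subset_Icc_self ht
      refine (norm_mul_le _ _).trans (mul_le_mul ((norm_mul_le _ _).trans
        (mul_le_mul (hBC θ t ht') (hDC θ t ht') (norm_nonneg _) ?_)) (hZC θ t ht')
        (norm_nonneg _) ?_)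
      · exact mul_nonneg hC (by linarith)
      · exact mul_nonneg (mul_nonneg hC (by linarith)) hC
    · refine Eventually.of_forall fun t ht => ?_
      rw [uIoc_of_le hab.le] at ht
      have ht' := Ioc_subset_Icc_self ht
      refine squeeze_zero_norm (a := fun θ => ‖B θ t‖ * C * C) (fun θ => ?_) ?_
      · refine (norm_mul_le _ _).trans (mul_le_mul ((norm_mul_le _ _).trans
          (mul_le_mul le_rfl (hDC θ t ht') (norm_nonneg _) (norm_nonneg _))) (hZC θ t ht')
          (norm_nonneg _) (by positivity))
      · simpa using ((hB t ht').norm.mul_const C).mul_const C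
  have h3 := (h1.const_add 1).sub h2
  rw [add_zero, sub_zero] at h3
  exact h3.congr fun θ => (hformula θ).symm

/-- The one-parameter group `x ↦ exp (i x J)` of an involution `J`. -/
def rot (J : 𝔸) (x : ℝ) : 𝔸 := (Real.cos x : ℂ) • 1 + (Real.sin x * Complex.I : ℂ) • J

@[simp] theorem rot_zero (J : 𝔸) : rot J 0 = 1 := by simp [rot]

theorem rot_mul_rot {J : 𝔸} (hJ : J * J = 1) (x y : ℝ) : rot J x * rot J y = rot J (x + y) := by
  simp only [rot, mul_add, add_mul, smul_mul_assoc, mul_smul_comm, one_mul, mul_one, hJ,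
    Real.cos_add, Real.sin_add]
  push_cast
  match_scalars
  · ring_nf
    simp [Complex.I_sq]
    ring
  · ring

theorem star_rot {J : 𝔸} (hJ : star J = J) (x : ℝ) : star (rot J x) = rot J (-x) := by
  simp [rot, hJ, Complex.conj_ofReal, -Complex.ofReal_cos, -Complex.ofReal_sin]

theorem commute_rot (J : 𝔸) (x : ℝ) : J * rot J x = rot J x * J := by
  simp [rot, mul_add, add_mul]

theorem mul_rot_of_anticommute {J M : 𝔸} (h : M * J = -(J * M)) (x : ℝ) :
    M * rot J x = rot J (-x) * M := by
  simp [rot, mul_add, add_mul, h]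

theorem hasDerivAt_rot {J : 𝔸} (hJ : J * J = 1) (x : ℝ) :
    HasDerivAt (rot J) (Complex.I • (J * rot J x)) x := by
  have h1 := (Real.hasDerivAt_cos x).ofReal_comp.smul_const (1 : 𝔸)
  have h2 := ((Real.hasDerivAt_sin x).ofReal_comp.mul_const Complex.I).smul_const J
  convert! h1.add h2 using 1
  simp only [rot, mul_add, mul_smul_comm, mul_one, hJ]
  match_scalars
  · simp
    ring
  · ring_nf
    simp [Complex.I_sq]

theorem continuous_rot {J : 𝔸} (hJ : J * J = 1) : Continuous (rot J) :=
  continuous_iff_continuousAt.2 fun x => (hasDerivAt_rot hJ x).continuousAt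

theorem norm_rot_le (J : 𝔸) (x : ℝ) : ‖rot J x‖ ≤ ‖(1 : 𝔸)‖ + ‖J‖ := by
  refine (norm_add_le _ _).trans (add_le_add ?_ ?_)
  · rw [norm_smul]
    refine mul_le_of_le_one_left (norm_nonneg _) ?_
    rw [Complex.norm_real]
    exact Real.abs_cos_le_one x
  · rw [norm_smul]
    refine mul_le_of_le_one_left (norm_nonneg _) ?_
    rw [norm_mul, Complex.norm_I, mul_one, Complex.norm_real]
    exact Real.abs_sin_le_one x

theorem rot_eq_exp (J : 𝔸) (x : ℝ) : rot J x =
    Complex.exp (Complex.I * (x : ℝ)) • ((1 / 2 : ℂ) • (1 + J)) +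
      Complex.exp (-(Complex.I * (x : ℝ))) • ((1 / 2 : ℂ) • (1 - J)) := by
  have h1 : Complex.exp (Complex.I * (x : ℝ)) = Complex.cos x + Complex.sin x * Complex.I := by
    rw [mul_comm, Complex.exp_mul_I]
  have h2 : Complex.exp (-(Complex.I * (x : ℝ))) =
      Complex.cos x - Complex.sin x * Complex.I := by
    rw [show -(Complex.I * (x : ℝ)) = (-(x : ℂ)) * Complex.I by ring, Complex.exp_mul_I]
    simp [sub_eq_add_neg]
  rw [h1, h2, rot]
  push_cast
  match_scalars <;> ring

/-- The integral of an oscillating coefficient `M exp (i θ Φ J)`, where the phase `Φ` has no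
stationary point, vanishes as `θ → ±∞`. -/
theorem tendsto_integral_mul_rot {M : ℝ → 𝔸} {J : 𝔸} {Φ φ : ℝ → ℝ} {a b : ℝ} (hab : a ≤ b)
    (hM : ContinuousOn M (Icc a b)) (hΦc : ContinuousOn Φ (Icc a b))
    (hΦ : ∀ t ∈ Ioo a b, HasDerivAt Φ (φ t) t) (hφ : ∀ t ∈ Ioo a b, φ t ≠ 0) :
    Tendsto (fun θ => ∫ s in a..b, M s * rot J (θ * Φ s)) (cocompact ℝ) (𝓝 0) := by
  have h1 := tendsto_integral_exp_phase hΦ hφ fun s => M s * ((1 / 2 : ℂ) • (1 + J))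
  have h2 := tendsto_integral_exp_phase (Φ := fun s => -Φ s) (φ := fun s => -φ s)
    (fun t ht => (hΦ t ht).neg) (fun t ht => neg_ne_zero.2 (hφ t ht))
    fun s => M s * ((1 / 2 : ℂ) • (1 - J))
  have h := h1.add h2
  rw [add_zero] at h
  refine h.congr fun θ => ?_
  have hc : ∀ (Ψ : ℝ → ℝ) (L : 𝔸), ContinuousOn Ψ (Icc a b) → IntegrableOn
      (fun s => Complex.exp (Complex.I * (θ * Ψ s : ℝ)) • (M s * L)) (Ioo a b) volume := by
    intro Ψ L hΨ
    have : ContinuousOn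
        (fun s => Complex.exp (Complex.I * (θ * Ψ s : ℝ)) • (M s * L)) (Icc a b) := by
      fun_prop
    exact (this.integrableOn_Icc).mono_set Ioo_subset_Icc_self
  rw [← integral_add (hc _ _ hΦc) (hc (fun s => -Φ s) _ hΦc.neg),
    intervalIntegral.integral_of_le hab, integral_Ioc_eq_integral_Ioo]
  refine setIntegral_congr_fun measurableSet_Ioo fun s _ => ?_
  simp only [rot_eq_exp, mul_add, mul_smul_comm]
  congr 3
  push_cast
  ring_nf

/-! ### The adiabatic theorem -/

/-- **Adiabatic theorem.** Let `N` be a `C¹` family of self-adjoint involutions and let `ρ` vanish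
at most at the endpoints. For large `θ` the transports of `(i θ ρ / 2) N` are asymptotic to the
transport of `½ N' N`, which conjugates `N a` into `N t`, times the phase factor
`exp (i θ φ (N a))` with `φ = ½ ∫ ρ`. -/
theorem exists_tendsto_transport_sub_rot [IsDedekindFiniteMonoid 𝔸] {N N' : ℝ → 𝔸} {ρ : ℝ → ℝ}
    {a b : ℝ} (hab : a < b)
    (hN : ∀ t ∈ Icc a b, HasDerivAt N (N' t) t) (hN' : ContinuousOn N' (Icc a b))
    (hsq : ∀ t ∈ Icc a b, N t * N t = 1) (hsa : ∀ t ∈ Icc a b, star (N t) = N t)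
    (hρ : ContinuousOn ρ (Icc a b)) (hρ0 : ∀ t ∈ Ioo a b, ρ t ≠ 0) :
    ∃ (X : 𝔸) (φ : ℝ), ∀ g : ℝ → 𝔸,
      (∀ θ : ℝ, IsTransport (fun t => ((θ * ρ t / 2 : ℝ) * Complex.I : ℂ) • N t) a b (g θ)) →
      Tendsto (fun θ => g θ - X * rot (N a) (θ * φ)) (cocompact ℝ) (𝓝 0) := by
  classical
  have haI : a ∈ Icc a b := ⟨le_rfl, hab.le⟩
  have hbI : b ∈ Icc a b := ⟨hab.le, le_rfl⟩
  have hNc : ContinuousOn N (Icc a b) := fun t ht => (hN t ht).continuousAt.continuousWithinAt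
  have hmem : ∀ t ∈ Ioo a b, Icc a b ∈ 𝓝 t := fun t ht => Icc_mem_nhds ht.1 ht.2
  -- Differentiating `N² = 1` and `N* = N`.
  have hanti : ∀ t ∈ Ioo a b, N t * N' t = -(N' t * N t) := by
    intro t ht
    have h1 := (hN t ⟨ht.1.le, ht.2.le⟩).mul (hN t ⟨ht.1.le, ht.2.le⟩)
    have h2 : HasDerivAt (N * N) 0 t :=
      (hasDerivAt_const t (1 : 𝔸)).congr_of_eventuallyEq
        (Filter.eventually_of_mem (hmem t ht) fun s hs => hsq s hs)
    exact (neg_eq_of_add_eq_zero_right (h1.unique h2)).symm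
  have hN'sa : ∀ t ∈ Ioo a b, star (N' t) = N' t := by
    intro t ht
    have h1 := (hN t ⟨ht.1.le, ht.2.le⟩).star
    exact (h1.congr_of_eventuallyEq (Filter.eventually_of_mem (hmem t ht)
      fun s hs => (hsa s hs).symm)).unique (hN t ⟨ht.1.le, ht.2.le⟩)
  set K : ℝ → 𝔸 := fun t => (1 / 2 : ℂ) • (N' t * N t) with hKdef
  have hKc : ContinuousOn K (Icc a b) := (hN'.mul hNc).const_smul _
  have hKstar : ∀ t ∈ Ioo a b, star (K t) = -K t := by
    intro t ht
    simp only [hKdef, star_smul, star_mul, hN'sa t ht, hsa t ⟨ht.1.le, ht.2.le⟩, hanti t ht]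
    simp
  obtain ⟨X, V, hVc, hVa, hVb, S₀, hV⟩ := exists_isTransport hab hKc
  have hVV : ∀ t ∈ Icc a b, star (V t) * V t = 1 := fun t ht => by
    rw [star_mul_eq_of_hasDerivAt hKstar hVc hVc S₀ hV hV ht, hVa]; simp
  have hVV' : ∀ t ∈ Icc a b, V t * star (V t) = 1 := fun t ht => mul_eq_one_symm (hVV t ht)
  set J := N a with hJdef
  have hJ : J * J = 1 := hsq a haI
  have hJs : star J = J := hsa a haI
  -- `V` intertwines `J = N a` with `N t`, because `N V - V J` solves the equation of `V`.
  have hNV : ∀ t ∈ Icc a b, N t * V t = V t * J := by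
    intro t ht
    have hYc : ContinuousOn (fun t => N t * V t - V t * J) (Icc a b) :=
      (hNc.mul hVc).sub (hVc.mul continuousOn_const)
    have hY : ∀ t ∈ Ioo a b, t ∉ S₀ →
        HasDerivAt (fun t => N t * V t - V t * J) (K t * (N t * V t - V t * J)) t := by
      intro s hs hsS
      have hs' : s ∈ Icc a b := ⟨hs.1.le, hs.2.le⟩
      convert! ((hN s hs').mul (hV s hs hsS)).sub ((hV s hs hsS).mul_const J) using 1
      have e1 : N s * K s = K s * N s - N' s := by
        simp only [hKdef, mul_smul_comm, smul_mul_assoc, ← mul_assoc, hanti s hs]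
        simp only [mul_assoc, neg_mul, hsq s hs', mul_one]
        module
      rw [← mul_assoc (N s), e1]
      noncomm_ring
    have h := star_mul_eq_of_hasDerivAt hKstar hYc hYc S₀ hY hY ht
    simp only [hVa, ← hJdef, mul_one, one_mul, sub_self, star_zero, zero_mul] at h
    exact sub_eq_zero.1 (CStarRing.star_mul_self_eq_zero_iff _ |>.1 h)
  have hVN : ∀ t ∈ Icc a b, star (V t) * N t = J * star (V t) := fun t ht => by
    have := congrArg star (hNV t ht)
    rwa [star_mul, star_mul, hsa t ht, hJs] at this
  set Φ : ℝ → ℝ := fun t => ∫ s in a..t, ρ s / 2 with hΦdef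
  have hρ2 : ContinuousOn (fun s => ρ s / 2) (Icc a b) := hρ.div_const 2
  have hρi : ∀ t ∈ Icc a b, IntervalIntegrable (fun s => ρ s / 2) volume a t := fun t ht =>
    (hρ2.mono (by rw [uIcc_of_le ht.1]; exact Icc_subset_Icc_right ht.2)).intervalIntegrable
  have hΦ : ∀ t ∈ Ioo a b, HasDerivAt Φ (ρ t / 2) t := fun t ht =>
    intervalIntegral.integral_hasDerivAt_right (hρi t ⟨ht.1.le, ht.2.le⟩)
      (hρ2.mono Ioo_subset_Icc_self |>.stronglyMeasurableAtFilter isOpen_Ioo t ht)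
      (hρ2.continuousAt (Icc_mem_nhds ht.1 ht.2))
  have hΦc : ContinuousOn Φ (Icc a b) := by
    have := intervalIntegral.continuousOn_primitive_interval' (hρi b hbI) left_mem_uIcc
    rwa [uIcc_of_le hab.le] at this
  have hΦa : Φ a = 0 := intervalIntegral.integral_same
  set M : ℝ → 𝔸 := fun t => (-(1 / 2) : ℂ) • (star (V t) * (N' t * N t) * V t) with hMdef
  have hMc : ContinuousOn M (Icc a b) := ((hVc.star.mul (hN'.mul hNc)).mul hVc).const_smul _
  have hMJ : ∀ t ∈ Ioo a b, M t * J = -(J * M t) := by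
    intro t ht
    have ht' : t ∈ Icc a b := ⟨ht.1.le, ht.2.le⟩
    have h1 : star (V t) * (N' t * N t) * V t * J = star (V t) * N' t * V t := by
      rw [mul_assoc, ← hNV t ht']
      simp only [mul_assoc]
      rw [← mul_assoc (N t) (N t), hsq t ht', one_mul]
    have h2 : J * (star (V t) * (N' t * N t) * V t) = -(star (V t) * N' t * V t) := by
      rw [← mul_assoc, ← mul_assoc, ← hVN t ht', mul_assoc (star (V t)), ← mul_assoc (N t),
        hanti t ht, neg_mul, mul_assoc (N' t), hsq t ht', mul_one, mul_neg, neg_mul]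
    simp only [hMdef, smul_mul_assoc, mul_smul_comm, h1, h2, smul_neg, neg_neg]
  refine ⟨X, Φ b, fun g hg => ?_⟩
  choose U hUc hUa hUb S hU using hg
  have hskew : ∀ θ : ℝ, ∀ t ∈ Ioo a b, star (((θ * ρ t / 2 : ℝ) * Complex.I : ℂ) • N t) =
      -(((θ * ρ t / 2 : ℝ) * Complex.I : ℂ) • N t) := by
    intro θ t ht
    rw [star_smul, hsa t ⟨ht.1.le, ht.2.le⟩, ← neg_smul]
    congr 1
    simp
  have hUU : ∀ θ, ∀ t ∈ Icc a b, star (U θ t) * U θ t = 1 := fun θ t ht => by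
    rw [star_mul_eq_of_hasDerivAt (hskew θ) (hUc θ) (hUc θ) (S θ) (hU θ) (hU θ) ht, hUa]; simp
  -- `Z` is the transport in the comoving frame, with the dynamical phase removed.
  set Z : ℝ → ℝ → 𝔸 := fun θ t => rot J (-(θ * Φ t)) * star (V t) * U θ t with hZdef
  have hZZ : ∀ θ, ∀ t ∈ Icc a b, star (Z θ t) * Z θ t = 1 := by
    intro θ t ht
    simp only [hZdef, star_mul, star_star, star_rot hJs, neg_neg]
    calc star (U θ t) * (V t * rot J (θ * Φ t)) * (rot J (-(θ * Φ t)) * star (V t) * U θ t)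
        = star (U θ t) * (V t * (rot J (θ * Φ t) * rot J (-(θ * Φ t))) * star (V t)) * U θ t := by
          noncomm_ring
      _ = 1 := by rw [rot_mul_rot hJ, add_neg_cancel, rot_zero, mul_one, hVV' t ht, mul_one,
          hUU θ t ht]
  have hZb : Tendsto (fun θ => Z θ b) (cocompact ℝ) (𝓝 1) := by
    obtain ⟨C₁, hC₁⟩ := isCompact_Icc.exists_bound_of_continuousOn hMc
    have hC₁0 : 0 ≤ C₁ := (norm_nonneg _).trans (hC₁ a haI)
    refine tendsto_one_of_tendsto_primitive (D := fun θ t => M t * rot J (θ * (2 * Φ t)))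
      (C := max (C₁ * (‖(1 : 𝔸)‖ + ‖J‖)) (max 1 ‖(1 : 𝔸)‖)) hab ?_ ?_ ?_ ?_ ?_ ?_ ?_
    · intro θ
      exact hMc.mul ((continuous_rot hJ).comp_continuousOn
        (continuousOn_const.mul (continuousOn_const.mul hΦc)))
    · intro θ t ht
      refine le_trans ?_ (le_max_left _ _)
      exact (norm_mul_le _ _).trans (mul_le_mul (hC₁ t ht) (norm_rot_le _ _) (norm_nonneg _) hC₁0)
    · intro θ
      exact (((continuous_rot hJ).comp_continuousOn (continuousOn_const.mul hΦc).neg).mul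
        hVc.star).mul (hUc θ)
    · intro θ
      simp [hZdef, hΦa, hVa, hUa]
    · intro θ t ht
      refine le_trans ?_ (le_max_right _ _)
      have h := CStarRing.norm_star_mul_self (x := Z θ t)
      rw [hZZ θ t ht] at h
      have h1 := le_max_left 1 ‖(1 : 𝔸)‖
      have h2 := le_max_right 1 ‖(1 : 𝔸)‖
      rw [h] at h1 h2 ⊢
      by_contra! hlt
      nlinarith [norm_nonneg (Z θ t)]
    · intro θ
      refine ⟨S₀ ∪ S θ, fun t ht htS => ?_⟩
      have ht' : t ∈ Icc a b := ⟨ht.1.le, ht.2.le⟩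
      have hR : HasDerivAt (fun t => rot J (-(θ * Φ t)))
          ((-(θ * (ρ t / 2))) • (Complex.I • (J * rot J (-(θ * Φ t))))) t :=
        HasDerivAt.scomp t (hasDerivAt_rot hJ _) ((hΦ t ht).const_mul θ).neg
      have hVt := (hV t ht (by simp_all)).star
      have hUt := hU θ t ht (by simp_all)
      convert! (hR.mul hVt).mul hUt using 1
      -- The terms with `ρ` cancel. In the remaining one, `M` anticommutes with `J`, so the phase
      -- factors on its two sides combine into `exp (2 i θ Φ J)` instead of cancelling.
      set R := rot J (-(θ * Φ t)) with hRdef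
      have hMR : M t * rot J (θ * (2 * Φ t)) * R = R * M t := by
        rw [mul_assoc, rot_mul_rot hJ, show θ * (2 * Φ t) + -(θ * Φ t) = θ * Φ t by ring,
          mul_rot_of_anticommute (hMJ t ht)]
      have hMV : M t * star (V t) = star (V t) * star (K t) := by
        rw [hKstar t ht]
        simp only [hMdef, hKdef, smul_mul_assoc, mul_assoc, hVV' t ht', mul_one, mul_neg,
          neg_mul, mul_smul_comm, neg_smul]
      have hJR : J * R = R * J := commute_rot J _
      have e1 : M t * rot J (θ * (2 * Φ t)) * Z θ t = R * (star (V t) * star (K t)) * U θ t := by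
        calc M t * rot J (θ * (2 * Φ t)) * (R * star (V t) * U θ t)
            = M t * rot J (θ * (2 * Φ t)) * R * star (V t) * U θ t := by simp only [mul_assoc]
          _ = R * (star (V t) * star (K t)) * U θ t := by rw [hMR, ← hMV]; simp only [mul_assoc]
      rw [e1, star_mul, hJR]
      have e2 : R * star (V t) * (((θ * ρ t / 2 : ℝ) * Complex.I : ℂ) • N t * U θ t) =
          ((θ * ρ t / 2 : ℝ) * Complex.I : ℂ) • (R * J * star (V t) * U θ t) := by
        rw [smul_mul_assoc, mul_smul_comm, mul_assoc R J, ← hVN t ht']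
        simp only [mul_assoc]
      change _ = _ + R * star (V t) * (((θ * ρ t / 2 : ℝ) * Complex.I : ℂ) • N t * U θ t)
      rw [e2, add_mul]
      simp only [smul_mul_assoc, ← mul_assoc]
      rw [← Complex.coe_smul]
      push_cast
      module
    · intro t ht
      refine tendsto_integral_mul_rot ht.1 (hMc.mono (Icc_subset_Icc_right ht.2))
        (continuousOn_const.mul (hΦc.mono (Icc_subset_Icc_right ht.2)))
        (φ := fun s => 2 * (ρ s / 2))
        (fun s hs => (hΦ s ⟨hs.1, hs.2.trans_le ht.2⟩).const_mul 2) (fun s hs => ?_)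
      have := hρ0 s ⟨hs.1, hs.2.trans_le ht.2⟩
      simpa using this
  -- Undo the change of frame; the frame is unitary, so the error stays small.
  have hg : ∀ θ, g θ - X * rot J (θ * Φ b) = X * rot J (θ * Φ b) * (Z θ b - 1) := by
    intro θ
    have : X * rot J (θ * Φ b) * Z θ b = g θ := by
      simp only [hZdef]
      rw [← hVb, ← hUb]
      calc V b * rot J (θ * Φ b) * (rot J (-(θ * Φ b)) * star (V b) * U θ b)
          = V b * (rot J (θ * Φ b) * rot J (-(θ * Φ b))) * star (V b) * U θ b := by noncomm_ring
        _ = U θ b := by rw [rot_mul_rot hJ, add_neg_cancel, rot_zero, mul_one, hVV' b hbI, one_mul]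
    rw [mul_sub, mul_one, this]
  refine squeeze_zero_norm (a := fun θ => ‖X‖ * (‖(1 : 𝔸)‖ + ‖J‖) * ‖Z θ b - 1‖)
    (fun θ => ?_) ?_
  · rw [hg]
    refine (norm_mul_le _ _).trans (mul_le_mul_of_nonneg_right ?_ (norm_nonneg _))
    exact (norm_mul_le _ _).trans (mul_le_mul_of_nonneg_left (norm_rot_le _ _) (norm_nonneg _))
  · have h := (hZb.sub_const 1).norm.const_mul (‖X‖ * (‖(1 : 𝔸)‖ + ‖J‖))
    simpa using h

end CStar

/-! ### Trigonometric polynomials and functions vanishing at infinity -/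

open scoped Matrix.Norms.L2Operator

theorem exp_mem_CylS (μ : ℝ) : (fun c : ℝ => Complex.exp (Complex.I * μ * c)) ∈ CylS :=
  Submodule.subset_span ⟨μ, rfl⟩

theorem one_mem_CylS : (1 : ℝ → ℂ) ∈ CylS := by
  convert! exp_mem_CylS 0 using 1
  funext c
  simp

theorem mul_mem_CylS {f g : ℝ → ℂ} (hf : f ∈ CylS) (hg : g ∈ CylS) : f * g ∈ CylS := by
  have h := Submodule.mul_mem_mul hf hg
  rw [CylS, Submodule.span_mul_span] at h
  refine Submodule.span_mono ?_ h
  rintro _ ⟨_, ⟨μ, rfl⟩, _, ⟨ν, rfl⟩, rfl⟩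
  refine ⟨μ + ν, funext fun c => ?_⟩
  simp only [Pi.mul_apply, ← Complex.exp_add]
  congr 1
  push_cast
  ring

theorem exists_bound_of_mem_CylS {f : ℝ → ℂ} (hf : f ∈ CylS) : ∃ C, ∀ c, ‖f c‖ ≤ C := by
  induction hf using Submodule.span_induction with
  | mem f h =>
    obtain ⟨μ, rfl⟩ := h
    refine ⟨1, fun c => ?_⟩
    change ‖Complex.exp (Complex.I * μ * c)‖ ≤ 1
    rw [show Complex.I * μ * c = (μ * c : ℝ) * Complex.I by push_cast; ring,
      Complex.norm_exp_ofReal_mul_I]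
  | zero => exact ⟨0, fun c => by simp⟩
  | add f g _ _ hf hg =>
    obtain ⟨C, hC⟩ := hf
    obtain ⟨D, hD⟩ := hg
    exact ⟨C + D, fun c => (norm_add_le _ _).trans (add_le_add (hC c) (hD c))⟩
  | smul z f _ hf =>
    obtain ⟨C, hC⟩ := hf
    exact ⟨‖z‖ * C, fun c => by
      rw [Pi.smul_apply, norm_smul]
      exact mul_le_mul_of_nonneg_left (hC c) (norm_nonneg _)⟩

theorem comp_mul_mem_CylS {f : ℝ → ℂ} (hf : f ∈ CylS) (r : ℝ) : (fun c => f (r * c)) ∈ CylS := by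
  induction hf using Submodule.span_induction with
  | mem f h =>
    obtain ⟨μ, rfl⟩ := h
    convert! exp_mem_CylS (μ * r) using 1
    funext c
    change Complex.exp (Complex.I * μ * (r * c : ℝ)) = Complex.exp (Complex.I * (μ * r : ℝ) * c)
    push_cast
    ring_nf
  | zero => exact CylS.zero_mem
  | add f g _ _ hf hg => exact CylS.add_mem hf hg
  | smul z f _ hf => exact CylS.smul_mem z hf

theorem cos_mem_CylS (μ : ℝ) : (fun c : ℝ => (Real.cos (c * μ) : ℂ)) ∈ CylS := by
  convert! CylS.smul_mem (1 / 2 : ℂ) (CylS.add_mem (exp_mem_CylS μ) (exp_mem_CylS (-μ))) using 1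
  funext c
  simp only [Pi.smul_apply, Pi.add_apply, smul_eq_mul, Complex.ofReal_cos, Complex.cos]
  push_cast
  ring_nf

theorem sin_mul_I_mem_CylS (μ : ℝ) :
    (fun c : ℝ => (Real.sin (c * μ) * Complex.I : ℂ)) ∈ CylS := by
  convert! CylS.smul_mem (1 / 2 : ℂ) (CylS.sub_mem (exp_mem_CylS μ) (exp_mem_CylS (-μ))) using 1
  funext c
  simp only [Pi.smul_apply, Pi.sub_apply, smul_eq_mul, Complex.ofReal_sin, Complex.sin]
  push_cast
  ring_nf
  rw [Complex.I_sq]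
  ring

theorem tendsto_mul_zero_of_bound {f g : ℝ → ℂ} {l : Filter ℝ} {C : ℝ} (hf : ∀ c, ‖f c‖ ≤ C)
    (hg : Tendsto g l (𝓝 0)) : Tendsto (f * g) l (𝓝 0) := by
  refine squeeze_zero_norm (a := fun c => C * ‖g c‖) (fun c => ?_) ?_
  · rw [Pi.mul_apply, norm_mul]
    exact mul_le_mul_of_nonneg_right (hf c) (norm_nonneg _)
  · simpa using hg.norm.const_mul C

/-- The functions on the line which differ from a trigonometric polynomial by a function that
vanishes at `±∞`. -/
def asympTrig : Subalgebra ℂ (ℝ → ℂ) where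
  carrier := {f | ∃ s ∈ CylS, Tendsto (f - s) (cocompact ℝ) (𝓝 0)}
  algebraMap_mem' z := ⟨algebraMap ℂ (ℝ → ℂ) z, by
    rw [Algebra.algebraMap_eq_smul_one]
    exact CylS.smul_mem z one_mem_CylS, by
    rw [sub_self]
    exact tendsto_const_nhds⟩
  add_mem' {f g} := by
    rintro ⟨s, hs, hf⟩ ⟨t, ht, hg⟩
    refine ⟨s + t, CylS.add_mem hs ht, ?_⟩
    rw [add_sub_add_comm, ← add_zero (0 : ℂ)]
    exact hf.add hg
  mul_mem' {f g} := by
    rintro ⟨s, hs, hf⟩ ⟨t, ht, hg⟩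
    refine ⟨s * t, mul_mem_CylS hs ht, ?_⟩
    obtain ⟨C, hC⟩ := exists_bound_of_mem_CylS hs
    obtain ⟨D, hD⟩ := exists_bound_of_mem_CylS ht
    have h := ((tendsto_mul_zero_of_bound hC hg).add (tendsto_mul_zero_of_bound hD hf)).add
      (hf.mul hg)
    simp only [add_zero, mul_zero] at h
    refine h.congr fun c => ?_
    simp only [Pi.mul_apply, Pi.sub_apply]
    ring

theorem comp_mul_mem_asympTrig {f : ℝ → ℂ} (hf : f ∈ asympTrig) {r : ℝ} (hr : r ≠ 0) :
    (fun c => f (r * c)) ∈ asympTrig := by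
  obtain ⟨s, hs, h⟩ := hf
  exact ⟨_, comp_mul_mem_CylS hs r,
    h.comp (Homeomorph.mulLeft₀ r hr).isClosedEmbedding.tendsto_cocompact⟩

/-! ### Asymptotics of the transport along piecewise analytic velocities -/

/-- The matrix `u · σ = 2i u^i τ_i`. -/
def pauli : Space →ₗ[ℝ] Matrix (Fin 2) (Fin 2) ℂ where
  toFun u := ∑ i, (u i : ℂ) • ((2 * Complex.I) • tau i)
  map_add' u v := by simp [add_smul, Finset.sum_add_distrib]
  map_smul' r u := by simp [Finset.smul_sum, mul_smul]

theorem pauli_apply (u : Space) : pauli u = !![(u 2 : ℂ), u 0 - Complex.I * u 1;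
    u 0 + Complex.I * u 1, -u 2] := by
  have h1 : Complex.I * (Complex.I * (u 1 : ℂ)) = -u 1 := by
    rw [← mul_assoc, Complex.I_mul_I]; ring
  have hI : Complex.I ^ 3 = -Complex.I := by rw [pow_succ, Complex.I_sq]; ring
  ext i j
  fin_cases i <;> fin_cases j <;>
  · simp [pauli, tau, Fin.sum_univ_three]
    ring_nf
    simp [Complex.I_sq, hI]
    try ring

theorem pauli_mul_pauli (u : Space) : pauli u * pauli u = ((‖u‖ ^ 2 : ℝ) : ℂ) • 1 := by
  rw [EuclideanSpace.real_norm_sq_eq, Fin.sum_univ_three, pauli_apply]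
  ext i j
  fin_cases i <;> fin_cases j <;>
  · simp [Matrix.mul_apply, Fin.sum_univ_two]
    ring_nf
    try simp [Complex.I_sq]
    try ring

theorem star_pauli (u : Space) : star (pauli u) = pauli u := by
  rw [pauli_apply, Matrix.star_eq_conjTranspose]
  ext i j
  fin_cases i <;> fin_cases j <;> simp [sub_eq_add_neg]

/-- The transports of `(i θ / 2) u · σ` on `[a, b]` exist for all `θ`, and their matrix elements
are asymptotically trigonometric polynomials in `θ`. -/
def HasAsympTrigTransport (u : ℝ → Space) (a b : ℝ) : Prop :=
  ∃ G : ℝ → Matrix (Fin 2) (Fin 2) ℂ,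
    (∀ θ : ℝ, IsTransport (fun t => ((θ / 2 : ℝ) * Complex.I : ℂ) • pauli (u t)) a b (G θ)) ∧
    ∀ B C, (fun θ => G θ B C) ∈ asympTrig

theorem HasAsympTrigTransport.trans {u : ℝ → Space} {a b c : ℝ} (hab : a < b) (hbc : b < c)
    (h : HasAsympTrigTransport u a b) (h' : HasAsympTrigTransport u b c) :
    HasAsympTrigTransport u a c := by
  obtain ⟨G, hG, hGm⟩ := h
  obtain ⟨G', hG', hGm'⟩ := h'
  refine ⟨fun θ => G' θ * G θ, fun θ => (hG θ).trans hab hbc (hG' θ), fun B C => ?_⟩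
  have : (fun θ => (G' θ * G θ) B C) = ∑ k, (fun θ => G' θ B k) * fun θ => G θ k C := by
    funext θ
    simp [Matrix.mul_apply]
  rw [this]
  exact asympTrig.sum_mem fun k _ => asympTrig.mul_mem (hGm' B k) (hGm k C)

/-- Locally a nonzero analytic velocity is a power of `t - t₀` times a smooth non-vanishing
field, so that its direction is smooth even at a zero and the adiabatic theorem applies on
either side of `t₀`. -/
theorem exists_hasAsympTrigTransport_near {v : ℝ → Space} {t₀ : ℝ} (hv : AnalyticAt ℝ v t₀) :
    ∃ ε > 0, ∀ a b, t₀ - ε < a → a < b → b < t₀ + ε → t₀ ∉ Ioo a b → ∀ u : ℝ → Space,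
      EqOn v u (Ioo a b) → HasAsympTrigTransport u a b := by
  by_cases h0 : ∀ᶠ t in 𝓝 t₀, v t = 0
  · obtain ⟨ε, hε, h⟩ := Metric.eventually_nhds_iff_ball.1 h0
    refine ⟨ε, hε, fun a b ha hab hb _ u hu => ⟨fun _ => 1, fun θ => ?_, fun B C => ?_⟩⟩
    · refine ⟨fun _ => 1, continuousOn_const, rfl, rfl, ∅, fun t ht _ => ?_⟩
      have hvt : v t = 0 := h t (by
        rw [Real.ball_eq_Ioo]; exact ⟨ha.trans ht.1, ht.2.trans hb⟩)
      have hu0 : u t = 0 := by rw [← hu ht, hvt]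
      simp only [hu0, map_zero, smul_zero, zero_mul]
      exact hasDerivAt_const t _
    · exact asympTrig.algebraMap_mem ((1 : Matrix (Fin 2) (Fin 2) ℂ) B C)
  obtain ⟨k, w, hw, hw0, hvw⟩ := hv.exists_eventuallyEq_pow_smul_nonzero_iff.2 h0
  obtain ⟨ε, hε, h⟩ := Metric.eventually_nhds_iff_ball.1
    (hvw.and (hw.eventually_analyticAt.and (hw.continuousAt.eventually_ne hw0)))
  rw [Real.ball_eq_Ioo] at h
  set I₀ := Ioo (t₀ - ε) (t₀ + ε) with hI₀
  have hwc : ContDiffOn ℝ 1 w I₀ := fun t ht => (h t ht).2.1.contDiffAt.contDiffWithinAt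
  set n : ℝ → Space := fun t => ‖w t‖⁻¹ • w t with hn
  have hnc : ContDiffOn ℝ 1 n I₀ :=
    ((hwc.norm ℝ fun t ht => (h t ht).2.2).inv fun t ht =>
      norm_ne_zero_iff.2 (h t ht).2.2).smul hwc
  have hn1 : ∀ t ∈ I₀, ‖n t‖ = 1 := fun t ht => norm_smul_inv_norm (𝕜 := ℝ) (h t ht).2.2
  set N : ℝ → Matrix (Fin 2) (Fin 2) ℂ := fun t => pauli (n t) with hNdef
  have hNc : ContDiffOn ℝ 1 N I₀ :=
    (LinearMap.toContinuousLinearMap pauli).contDiff.comp_contDiffOn hnc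
  refine ⟨ε, hε, fun a b ha hab hb hnot u hu => ?_⟩
  have hsub : Icc a b ⊆ I₀ := fun t ht => ⟨ha.trans_le ht.1, ht.2.trans_lt hb⟩
  set ρ : ℝ → ℝ := fun t => (t - t₀) ^ k * ‖w t‖ with hρdef
  have hρ : ContinuousOn ρ (Icc a b) :=
    (((continuous_id.sub continuous_const).pow k).continuousOn).mul
      (hwc.continuousOn.mono hsub).norm
  have hvn : ∀ t ∈ I₀, v t = ρ t • n t := by
    intro t ht
    rw [(h t ht).1, hρdef, hn]
    simp only
    rw [smul_smul, mul_assoc, mul_inv_cancel₀ (norm_ne_zero_iff.2 (h t ht).2.2), mul_one]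
  obtain ⟨X, φ, hX⟩ := exists_tendsto_transport_sub_rot (N := N) (N' := deriv N) (ρ := ρ) hab
    (fun t ht => ((hNc.differentiableOn one_ne_zero).differentiableAt
      (isOpen_Ioo.mem_nhds (hsub ht))).hasDerivAt)
    ((hNc.continuousOn_deriv_of_isOpen isOpen_Ioo le_rfl).mono hsub)
    (fun t ht => by simp [hNdef, pauli_mul_pauli, hn1 t (hsub ht)])
    (fun t _ => star_pauli _) hρ
    (fun t ht => mul_ne_zero (pow_ne_zero _ (sub_ne_zero.2 fun h' => hnot (h' ▸ ht)))
      (norm_ne_zero_iff.2 (h t (hsub (Ioo_subset_Icc_self ht))).2.2))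
  have hex : ∀ θ : ℝ, ∃ g,
      IsTransport (fun t => ((θ * ρ t / 2 : ℝ) * Complex.I : ℂ) • N t) a b g := by
    intro θ
    have h1 : ContinuousOn (fun t => ((θ * ρ t / 2 : ℝ) * Complex.I : ℂ)) (Icc a b) :=
      (Complex.continuous_ofReal.comp_continuousOn
        ((continuousOn_const.mul hρ).div_const 2)).mul continuousOn_const
    exact exists_isTransport hab (h1.smul (hNc.continuousOn.mono hsub))
  choose g hg using hex
  refine ⟨g, fun θ => (hg θ).congr fun t ht => ?_, fun B C => ?_⟩
  · have h1 : u t = ρ t • n t := by rw [← hu ht, hvn t (hsub (Ioo_subset_Icc_self ht))]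
    simp only [hNdef, h1, map_smul]
    rw [← Complex.coe_smul, smul_smul]
    congr 1
    push_cast
    ring
  · refine ⟨fun θ => (X * rot (N a) (θ * φ)) B C, ?_, ?_⟩
    · have : (fun θ => (X * rot (N a) (θ * φ)) B C) =
          (X B C) • (fun θ : ℝ => (Real.cos (θ * φ) : ℂ)) +
          ((X * N a) B C) • fun θ : ℝ => (Real.sin (θ * φ) * Complex.I : ℂ) := by
        funext θ
        simp only [rot, mul_add, mul_smul_comm, mul_one, Matrix.add_apply, Matrix.smul_apply,
          Pi.add_apply, Pi.smul_apply, smul_eq_mul]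
        ring
      rw [this]
      exact CylS.add_mem (CylS.smul_mem _ (cos_mem_CylS φ)) (CylS.smul_mem _ (sin_mul_I_mem_CylS φ))
    · have hcont : Continuous fun A : Matrix (Fin 2) (Fin 2) ℂ => A B C :=
        continuous_id.matrix_elem B C
      have := (hcont.tendsto 0).comp (hX g hg)
      exact this

/-- The velocity of a piecewise analytic path has analytic one-sided germs everywhere; the local
statement then propagates by continuous induction. -/
theorem hasAsympTrigTransport_of_germs {u : ℝ → Space} {a b : ℝ} (hab : a < b)
    (hr : ∀ t ∈ Ico a b, ∃ v, AnalyticAt ℝ v t ∧ v =ᶠ[𝓝[>] t] u)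
    (hl : ∀ t ∈ Ioc a b, ∃ v, AnalyticAt ℝ v t ∧ v =ᶠ[𝓝[<] t] u) :
    HasAsympTrigTransport u a b := by
  refine rel_of_local_rel hab (fun x y z => HasAsympTrigTransport.trans) ?_ ?_
  · intro t ht
    obtain ⟨v, hv, hvu⟩ := hr t ht
    obtain ⟨ε, hε, h⟩ := exists_hasAsympTrigTransport_near hv
    obtain ⟨r, hr, hsub⟩ := mem_nhdsGT_iff_exists_Ioo_subset.1 hvu
    filter_upwards [Ioo_mem_nhdsGT (show t < t + ε by linarith), Ioo_mem_nhdsGT hr] with s hs hs'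
    exact h t s (by linarith) hs.1 hs.2 (fun h => lt_irrefl _ h.1) u
      fun x hx => hsub ⟨hx.1, hx.2.trans hs'.2⟩
  · intro t ht
    obtain ⟨v, hv, hvu⟩ := hl t ht
    obtain ⟨ε, hε, h⟩ := exists_hasAsympTrigTransport_near hv
    obtain ⟨r, hr, hsub⟩ := mem_nhdsLT_iff_exists_Ioo_subset.1 hvu
    filter_upwards [Ioo_mem_nhdsLT (show t - ε < t by linarith), Ioo_mem_nhdsLT hr] with s hs hs'
    exact h s t hs.1 hs.2 (by linarith) (fun h => lt_irrefl _ h.2) u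
      fun x hx => hsub ⟨hs'.1.trans hx.1, hx.2⟩

/-! ### Homogeneous isotropic connections -/

/-- Translations make the components constant, so only their values at the origin enter the
invariance under a rotation `r`. -/
theorem comp_eq_of_mem_symmetricConnections {A : Connection} (hA : A ∈ symmetricConnections)
    (r : Matrix (Fin 3) (Fin 3) ℝ) (hr : r ∈ Matrix.specialOrthogonalGroup (Fin 3) ℝ)
    (i a : Fin 3) (y : Space) :
    A.comp i a y = ∑ j, ∑ b, r i j * A.comp j b 0 * r a b := by
  have h1 : A.comp i a y = A.comp i a 0 := by
    have h := congrFun (congrFun (congrFun (congrArg Connection.comp (hA y 1)) i) a) y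
    simpa [euclideanAct, Matrix.one_apply] using h.symm
  have h2 := congrFun (congrFun (congrFun (congrArg Connection.comp (hA 0 ⟨r, hr⟩)) i) a) 0
  rw [h1, ← h2]
  simp [euclideanAct]

/-- The homogeneous isotropic connections are the multiples of `δ^i_a τ_i dx^a`. -/
theorem exists_comp_eq_of_mem_symmetricConnections {A : Connection}
    (hA : A ∈ symmetricConnections) :
    ∃ p : ℝ, ∀ i a y, A.comp i a y = if i = a then p else 0 := by
  have key := comp_eq_of_mem_symmetricConnections hA
  -- The half turns about two axes kill the off-diagonal components, and the cyclic permutation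
  -- of the axes identifies the diagonal ones.
  have hx := key !![1, 0, 0; 0, -1, 0; 0, 0, -1] (by
    rw [Matrix.mem_specialOrthogonalGroup_iff, Matrix.mem_orthogonalGroup_iff]
    constructor
    · ext i j
      fin_cases i <;> fin_cases j <;> simp [Matrix.mul_apply, Fin.sum_univ_three]
    · simp [Matrix.det_fin_three])
  have hz := key !![-1, 0, 0; 0, -1, 0; 0, 0, 1] (by
    rw [Matrix.mem_specialOrthogonalGroup_iff, Matrix.mem_orthogonalGroup_iff]
    constructor
    · ext i j
      fin_cases i <;> fin_cases j <;> simp [Matrix.mul_apply, Fin.sum_univ_three]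
    · simp [Matrix.det_fin_three])
  have hp := key !![0, 1, 0; 0, 0, 1; 1, 0, 0] (by
    rw [Matrix.mem_specialOrthogonalGroup_iff, Matrix.mem_orthogonalGroup_iff]
    constructor
    · ext i j
      fin_cases i <;> fin_cases j <;> simp [Matrix.mul_apply, Fin.sum_univ_three]
    · simp [Matrix.det_fin_three])
  simp only [Fin.sum_univ_three] at hx hz hp
  have x01 := hx 0 1 0
  have x02 := hx 0 2 0
  have x10 := hx 1 0 0
  have x20 := hx 2 0 0
  have z12 := hz 1 2 0
  have z21 := hz 2 1 0
  have p00 := hp 0 0 0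
  have p11 := hp 1 1 0
  simp at x01 x02 x10 x20 z12 z21 p00 p11
  have hconst : ∀ i a y, A.comp i a y = A.comp i a 0 := fun i a y => by
    rw [hx i a y, hx i a 0]
  refine ⟨A.comp 0 0 0, fun i a y => ?_⟩
  rw [hconst]
  fin_cases i <;> fin_cases a <;> simp <;> linarith

/-! ### Holonomies of homogeneous isotropic connections -/

theorem neg_onVelocity_smul {A : Connection} {p : ℝ}
    (hA : ∀ i a y, A.comp i a y = if i = a then p else 0) (c : ℝ) (γ : ℝ → Space) (t : ℝ) :
    -((c • A).onVelocity γ t) = ((p * c / 2 : ℝ) * Complex.I : ℂ) • pauli (deriv γ t) := by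
  have h1 : ∀ i a, (c • A).comp i a (γ t) = if i = a then c * p else 0 := fun i a => by
    change c * A.comp i a (γ t) = _
    rw [hA]
    split_ifs <;> simp
  simp only [Connection.onVelocity, h1, mul_ite, mul_zero, pauli, LinearMap.coe_mk, AddHom.coe_mk,
    Finset.smul_sum, smul_smul, ← Finset.sum_neg_distrib, ← neg_smul]
  refine Finset.sum_congr rfl fun i _ => ?_
  rw [Finset.sum_eq_single i (fun b _ hb => by simp [hb.symm]) (by simp)]
  rw [if_pos rfl]
  congr 1
  push_cast
  linear_combination (-(p * c : ℂ) * deriv γ t i) * Complex.I_sq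

theorem hasDerivAt_matrix_iff {U : ℝ → Matrix (Fin 2) (Fin 2) ℂ} {U' : Matrix (Fin 2) (Fin 2) ℂ}
    {t : ℝ} : HasDerivAt U U' t ↔ ∀ B C, HasDerivAt (fun s => U s B C) (U' B C) t := by
  constructor
  · intro h B C
    exact (LinearMap.toContinuousLinearMap
      (Matrix.entryLinearMap ℝ ℂ B C)).hasFDerivAt.comp_hasDerivAt t h
  · intro h
    have h1 : ∀ M : Matrix (Fin 2) (Fin 2) ℂ,
        M = ∑ B, ∑ C, M B C • Matrix.single B C (1 : ℂ) := fun M => by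
      conv_lhs => rw [Matrix.matrix_eq_sum_single M]
      simp [Matrix.smul_single]
    have h2 : U = fun s => ∑ B, ∑ C, U s B C • Matrix.single B C (1 : ℂ) := funext fun s => h1 _
    rw [h1 U', h2]
    exact HasDerivAt.fun_sum fun B _ => HasDerivAt.fun_sum fun C _ => (h B C).smul_const _

theorem isHolonomy_iff_isTransport {A : Connection} {γ : ℝ → Space}
    {g : Matrix (Fin 2) (Fin 2) ℂ} :
    IsHolonomy A γ g ↔ IsTransport (fun t => -(A.onVelocity γ t)) 0 1 g := by
  simp only [IsHolonomy, IsTransport, hasDerivAt_matrix_iff]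

/-- Since `A(γ̇)` is skew-adjoint the holonomy is unique, so it is computed by any solution of the
transport equation. -/
theorem holonomy_smul_eq {A : Connection} {p : ℝ}
    (hA : ∀ i a y, A.comp i a y = if i = a then p else 0) {γ : ℝ → Space} {c : ℝ}
    {g : Matrix (Fin 2) (Fin 2) ℂ}
    (hg : IsTransport (fun t => ((p * c / 2 : ℝ) * Complex.I : ℂ) • pauli (deriv γ t)) 0 1 g) :
    holonomy (c • A) γ = g := by
  have hiff : ∀ g', IsHolonomy (c • A) γ g' ↔ IsTransport
      (fun t => ((p * c / 2 : ℝ) * Complex.I : ℂ) • pauli (deriv γ t)) 0 1 g' := fun g' => by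
    simp only [isHolonomy_iff_isTransport, neg_onVelocity_smul hA]
  have hhol : IsHolonomy (c • A) γ (holonomy (c • A) γ) :=
    Classical.epsilon_spec (p := IsHolonomy (c • A) γ) ⟨g, (hiff g).2 hg⟩
  refine ((hiff _).1 hhol).unique zero_le_one (fun t _ => ?_) hg
  rw [star_smul, star_pauli, ← neg_smul]
  congr 1
  simp

theorem exists_germ_deriv_right {γ : ℝ → Space} {a b t : ℝ} (h : AnalyticOn ℝ γ (Icc a b))
    (ht : t ∈ Ico a b) : ∃ v, AnalyticAt ℝ v t ∧ v =ᶠ[𝓝[>] t] deriv γ := by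
  have htI : t ∈ Icc a b := ⟨ht.1, ht.2.le⟩
  obtain ⟨g, hg, hga⟩ := analyticWithinAt_iff_exists_analyticAt.1 (h t htI)
  rw [insert_eq_of_mem htI] at hg
  have hg' : γ =ᶠ[𝓝[>] t] g := hg.filter_mono (nhdsWithin_le_of_mem (Icc_mem_nhdsGT_of_mem ht))
  refine ⟨deriv g, hga.deriv, ?_⟩
  filter_upwards [eventually_eventually_nhdsWithin.2 hg', self_mem_nhdsWithin] with y hy hyt
  rw [isOpen_Ioi.nhdsWithin_eq hyt] at hy
  exact (EventuallyEq.deriv_eq hy).symm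

theorem exists_germ_deriv_left {γ : ℝ → Space} {a b t : ℝ} (h : AnalyticOn ℝ γ (Icc a b))
    (ht : t ∈ Ioc a b) : ∃ v, AnalyticAt ℝ v t ∧ v =ᶠ[𝓝[<] t] deriv γ := by
  have htI : t ∈ Icc a b := ⟨ht.1.le, ht.2⟩
  obtain ⟨g, hg, hga⟩ := analyticWithinAt_iff_exists_analyticAt.1 (h t htI)
  rw [insert_eq_of_mem htI] at hg
  have hg' : γ =ᶠ[𝓝[<] t] g := hg.filter_mono (nhdsWithin_le_of_mem (Icc_mem_nhdsLT_of_mem ht))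
  refine ⟨deriv g, hga.deriv, ?_⟩
  filter_upwards [eventually_eventually_nhdsWithin.2 hg', self_mem_nhdsWithin] with y hy hyt
  rw [isOpen_Iio.nhdsWithin_eq hyt] at hy
  exact (EventuallyEq.deriv_eq hy).symm

theorem IsPiecewiseAnalytic.hasAsympTrigTransport {γ : ℝ → Space} (hγ : IsPiecewiseAnalytic γ) :
    HasAsympTrigTransport (deriv γ) 0 1 := by
  obtain ⟨n, p, hp, hp0, hp1, h⟩ := hγ
  have piece : ∀ k : Fin n, HasAsympTrigTransport (deriv γ) (p k.castSucc) (p k.succ) := fun k =>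
    hasAsympTrigTransport_of_germs (hp k.castSucc_lt_succ)
      (fun t ht => exists_germ_deriv_right (h k) ht) (fun t ht => exists_germ_deriv_left (h k) ht)
  have all : ∀ k : Fin (n + 1), k ≠ 0 → HasAsympTrigTransport (deriv γ) (p 0) (p k) := by
    intro k
    induction k using Fin.induction with
    | zero => exact fun h => absurd rfl h
    | succ k ih =>
      intro _
      by_cases hk : k.castSucc = 0
      · rw [← hk]; exact piece k
      · exact (ih hk).trans (hp (Fin.pos_of_ne_zero hk)) (hp k.castSucc_lt_succ) (piece k)
  have hlast : Fin.last n ≠ 0 := fun h0 => by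
    rw [h0, hp0] at hp1
    exact zero_ne_one hp1
  have := all _ hlast
  rwa [hp0, hp1] at this

/-- Along the symmetric connections every holonomy is asymptotically a trigonometric
polynomial. -/
theorem holonomy_smul_mem_asympTrig {A : Connection} {p : ℝ} (hp : p ≠ 0)
    (hA : ∀ i a y, A.comp i a y = if i = a then p else 0) {γ : ℝ → Space}
    (hγ : IsPiecewiseAnalytic γ) (B C : Fin 2) :
    (fun c : ℝ => holonomy (c • A) γ B C) ∈ asympTrig := by
  obtain ⟨G, hG, hGm⟩ := hγ.hasAsympTrigTransport
  have h : (fun c : ℝ => holonomy (c • A) γ B C) = fun c => G (p * c) B C := by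
    funext c
    rw [holonomy_smul_eq hA (hG (p * c))]
  rw [h]
  exact comp_mul_mem_asympTrig (hGm B C) hp

/-! ### The decomposition of the algebra of symmetric cylindrical functions -/

theorem CylF_le_asympTrig {A : Connection} {p : ℝ} (hp : p ≠ 0)
    (hA : ∀ i a y, A.comp i a y = if i = a then p else 0) : CylF A ≤ asympTrig := by
  rw [CylF, Cyl, AlgHom.map_adjoin]
  refine Algebra.adjoin_le ?_
  rintro _ ⟨_, ⟨γ, hγ, B, C, rfl⟩, rfl⟩
  exact holonomy_smul_mem_asympTrig hp hA hγ B C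

theorem isPiecewiseAnalytic_line (v : Space) : IsPiecewiseAnalytic fun t => t • v := by
  refine ⟨1, ![0, 1], ?_, rfl, rfl, fun k => ?_⟩
  · intro i j hij
    fin_cases i <;> fin_cases j <;> simp_all
  · exact analyticOn_id.smul analyticOn_const

/-- The holonomy along a straight segment in the third direction, from which all exponentials are
obtained. -/
theorem holonomy_line {A : Connection} {p : ℝ}
    (hA : ∀ i a y, A.comp i a y = if i = a then p else 0) (l c : ℝ) :
    holonomy (c • A) (fun t => t • EuclideanSpace.single (2 : Fin 3) l) 0 0 =
      Complex.exp (Complex.I * (p * l / 2 : ℝ) * c) := by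
  set N : Matrix (Fin 2) (Fin 2) ℂ := pauli (EuclideanSpace.single 2 1) with hN
  have hN00 : N 0 0 = 1 := by simp [hN, pauli_apply]
  have hNN : N * N = 1 := by simp [hN, pauli_mul_pauli]
  have hl : pauli (EuclideanSpace.single 2 l) = (l : ℂ) • N := by
    rw [Complex.coe_smul, hN, ← map_smul]
    congr 1
    ext i
    fin_cases i <;> simp
  have htr : IsTransport (fun t => ((p * c / 2 : ℝ) * Complex.I : ℂ) •
      pauli (deriv (fun t : ℝ => t • EuclideanSpace.single (2 : Fin 3) l) t)) 0 1
      (rot N (p * c / 2 * l)) := by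
    refine ⟨fun t => rot N (p * c / 2 * l * t), ?_, by simp, by simp, ∅, fun t _ _ => ?_⟩
    · exact ((continuous_rot hNN).comp (continuous_const.mul continuous_id)).continuousOn
    · have hd : deriv (fun t : ℝ => t • EuclideanSpace.single (2 : Fin 3) l) t =
          EuclideanSpace.single (2 : Fin 3) l := by
        simpa using ((hasDerivAt_id t).smul_const (EuclideanSpace.single (2 : Fin 3) l)).deriv
      have h := HasDerivAt.scomp t (hasDerivAt_rot hNN (p * c / 2 * l * t))
        ((hasDerivAt_id t).const_mul (p * c / 2 * l))
      convert! h using 1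
      simp only [hd]
      rw [hl, ← Complex.coe_smul]
      simp only [smul_mul_assoc, smul_smul]
      congr 1
      push_cast
      ring
  rw [holonomy_smul_eq hA htr, rot]
  simp only [Matrix.add_apply, Matrix.smul_apply, Matrix.one_apply_eq, hN00, smul_eq_mul, mul_one]
  rw [show Complex.I * (p * l / 2 : ℝ) * c = ((p * c / 2 * l : ℝ) : ℂ) * Complex.I by
    push_cast; ring, Complex.exp_mul_I]
  push_cast
  rfl

theorem CylS_le_CylF {A : Connection} {p : ℝ} (hp : p ≠ 0)
    (hA : ∀ i a y, A.comp i a y = if i = a then p else 0) :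
    CylS ≤ Subalgebra.toSubmodule (CylF A) := by
  refine Submodule.span_le.2 ?_
  rintro _ ⟨μ, rfl⟩
  refine ⟨fun B => holonomy B (fun t => t • EuclideanSpace.single (2 : Fin 3) (2 * μ / p)) 0 0,
    (holonomyElement _ (isPiecewiseAnalytic_line _) 0 0).2, funext fun c => ?_⟩
  change holonomy (c • A) _ 0 0 = _
  rw [holonomy_line hA]
  congr 4
  field_simp

/-- A trigonometric polynomial that vanishes at `±∞` has no nonzero coefficient, by induction
on the number of terms: the difference of a translate and a suitable multiple has one term less. -/
theorem trigPolynomial_coeff_eq_zero (s : Finset ℝ) : ∀ a : ℝ → ℂ,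
    Tendsto (fun c : ℝ => ∑ μ ∈ s, a μ * Complex.exp (Complex.I * μ * c)) (cocompact ℝ) (𝓝 0) →
    ∀ μ ∈ s, a μ = 0 := by
  induction s using Finset.induction_on with
  | empty => simp
  | insert ν s hν ih =>
    intro a ha
    have hs : ∀ μ ∈ s, a μ = 0 := by
      intro μ hμ
      have hne : μ - ν ≠ 0 := sub_ne_zero.2 fun h => hν (h ▸ hμ)
      set h : ℝ := Real.pi / (μ - ν) with hh
      have h1 := ha.comp (Homeomorph.addRight h).isClosedEmbedding.tendsto_cocompact
      have h2 := h1.sub (ha.const_mul (Complex.exp (Complex.I * ν * h)))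
      have h3 := ih (fun κ => a κ * (Complex.exp (Complex.I * κ * h) -
        Complex.exp (Complex.I * ν * h))) (by
          rw [mul_zero, sub_zero] at h2
          refine h2.congr fun c => ?_
          simp only [Function.comp_apply, Homeomorph.coe_addRight, Finset.sum_insert hν, mul_add,
            Finset.mul_sum, Complex.ofReal_add, Complex.exp_add]
          rw [show ∀ x y z w : ℂ, x + y - (z + w) = (x - z) + (y - w) by intros; ring,
            ← Finset.sum_sub_distrib]
          rw [show a ν * (Complex.exp (Complex.I * ν * c) * Complex.exp (Complex.I * ν * h)) -
            Complex.exp (Complex.I * ν * h) * (a ν * Complex.exp (Complex.I * ν * c)) = 0 by ring,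
            zero_add]
          exact Finset.sum_congr rfl fun κ _ => by ring) μ hμ
      refine (mul_eq_zero.1 h3).resolve_right fun h4 => ?_
      -- By the choice of `h`, the two phases are opposite.
      have h5 : Complex.exp (Complex.I * μ * h) = -Complex.exp (Complex.I * ν * h) := by
        have h6 : Complex.I * μ * h = Complex.I * ν * h + Real.pi * Complex.I := by
          have h7 : (μ - ν) * h = Real.pi := by rw [hh]; field_simp
          have h8 : ((μ : ℂ) - ν) * h = Real.pi := by exact_mod_cast h7
          rw [← h8]
          ring
        rw [h6, Complex.exp_add, Complex.exp_pi_mul_I]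
        ring
      rw [h5] at h4
      have h6 : Complex.exp (Complex.I * ν * h) = 0 := by linear_combination (-1 / 2 : ℂ) * h4
      exact Complex.exp_ne_zero _ h6
    have hν0 : a ν = 0 := by
      have h1 : Tendsto (fun _ : ℝ => ‖a ν‖) (cocompact ℝ) (𝓝 0) := by
        have h2 := ha.norm
        rw [norm_zero] at h2
        refine h2.congr fun c => ?_
        rw [Finset.sum_insert hν, Finset.sum_eq_zero fun μ hμ => by rw [hs μ hμ, zero_mul],
          add_zero, norm_mul, show Complex.I * ν * c = (ν * c : ℝ) * Complex.I by push_cast; ring,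
          Complex.norm_exp_ofReal_mul_I, mul_one]
      exact norm_eq_zero.1 (tendsto_nhds_unique tendsto_const_nhds h1)
    intro μ hμ
    rcases Finset.mem_insert.1 hμ with rfl | h
    · exact hν0
    · exact hs μ h

theorem eq_zero_of_mem_CylS_of_tendsto {f : ℝ → ℂ} (hf : f ∈ CylS)
    (h : Tendsto f (cocompact ℝ) (𝓝 0)) : f = 0 := by
  obtain ⟨a, rfl⟩ := Finsupp.mem_span_range_iff_exists_finsupp.1 hf
  have hsum : ∀ c, (a.sum fun μ z => z • fun c : ℝ => Complex.exp (Complex.I * μ * c)) c =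
      ∑ μ ∈ a.support, a μ * Complex.exp (Complex.I * μ * c) := fun c => by
    simp [Finsupp.sum]
  have h0 := trigPolynomial_coeff_eq_zero a.support a (h.congr hsum)
  funext c
  rw [hsum, Finset.sum_eq_zero fun μ hμ => by rw [h0 μ hμ, zero_mul], Pi.zero_apply]

/-- The part vanishing at infinity of an element of `Cyl_F` lies in `Cyl_F` itself, as the
trigonometric part does. -/
theorem decomposes_of_comp_eq {A : Connection} {p : ℝ} (hp : p ≠ 0)
    (hA : ∀ i a y, A.comp i a y = if i = a then p else 0) : Decomposes A := by
  refine ⟨CylS_le_CylF hp hA, ?_, ?_⟩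
  · rw [Submodule.disjoint_def]
    intro f hf hfV
    exact Subtype.ext (eq_zero_of_mem_CylS_of_tendsto hf hfV)
  · rw [codisjoint_iff, Submodule.eq_top_iff']
    intro f
    obtain ⟨s, hs, hsf⟩ := CylF_le_asympTrig hp hA f.2
    have hsF : s ∈ CylF A := CylS_le_CylF hp hA hs
    exact Submodule.mem_sup.2 ⟨⟨s, hsF⟩, hs, f - ⟨s, hsF⟩, hsf, add_sub_cancel _ _⟩

theorem mul_mem_CylV {A : Connection} {p : ℝ} (hp : p ≠ 0)
    (hA : ∀ i a y, A.comp i a y = if i = a then p else 0) (f : CylF A) {v : CylF A}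
    (hv : v ∈ CylV A) : f * v ∈ CylV A := by
  obtain ⟨s, hs, hsf⟩ := CylF_le_asympTrig hp hA f.2
  obtain ⟨C, hC⟩ := exists_bound_of_mem_CylS hs
  have hv' : Tendsto (v : ℝ → ℂ) (cocompact ℝ) (𝓝 0) := hv
  have h := (tendsto_mul_zero_of_bound hC hv').add (hsf.mul hv')
  rw [mul_zero, add_zero] at h
  refine h.congr fun c => ?_
  change s c * (v : ℝ → ℂ) c + ((f : ℝ → ℂ) c - s c) * (v : ℝ → ℂ) c =
    (f : ℝ → ℂ) c * (v : ℝ → ℂ) c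
  ring

/-! ### Dual spaces and the intertwining relation -/

section Projections

variable {A : Connection} (h : Decomposes A)

theorem projS_inclS (s : CylS) : projS h (inclS h s) = s := by
  have hs : inclS h s ∈ CylS.comap (CylF A).toSubmodule.subtype := s.2
  simp only [projS, LinearMap.comp_apply]
  rw [Submodule.projectionOnto_apply_of_mem_left h.2 hs]
  rfl

theorem projS_of_mem {v : CylF A} (hv : v ∈ CylV A) : projS h v = 0 := by
  simp only [projS, LinearMap.comp_apply]
  rw [(Submodule.projectionOnto_apply_eq_zero_iff h.2).2 hv, map_zero]

theorem projV_inclS (s : CylS) : projV h (inclS h s) = 0 :=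
  (Submodule.projectionOnto_apply_eq_zero_iff h.2.symm).2 s.2

theorem projV_coe (v : CylV A) : projV h v = v := Submodule.projectionOnto_apply_left _ v

theorem inclS_projS_add_projV (f : CylF A) : inclS h (projS h f) + projV h f = f := by
  have hmem : f ∈ CylS.comap (CylF A).toSubmodule.subtype ⊔ CylV A := by
    rw [h.2.sup_eq_top]; trivial
  obtain ⟨s, hs, v, hv, rfl⟩ := Submodule.mem_sup.1 hmem
  obtain ⟨s, rfl⟩ : ∃ s', inclS h s' = s := ⟨⟨s, hs⟩, rfl⟩
  lift v to CylV A using hv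
  rw [map_add (projS h), map_add (projV h), projS_inclS, projS_of_mem h v.2, projV_inclS,
    projV_coe, add_zero, zero_add]

theorem dualSum_bijective : Function.Bijective (dualSum h) := by
  constructor
  · rw [← LinearMap.ker_eq_bot, LinearMap.ker_eq_bot']
    rintro ⟨ψ, χ⟩ h0
    have happ : ∀ f, ψ (projS h f) + χ (projV h f) = 0 := fun f => LinearMap.congr_fun h0 f
    refine Prod.ext (LinearMap.ext fun s => ?_) (LinearMap.ext fun v => ?_)
    · simpa [projS_inclS, projV_inclS] using happ (inclS h s)
    · simpa [projS_of_mem h v.2, projV_coe] using happ v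
  · intro α
    refine ⟨(α ∘ₗ inclS h, α ∘ₗ (CylV A).subtype), LinearMap.ext fun f => ?_⟩
    change α (inclS h (projS h f)) + α (projV h f) = α f
    rw [← map_add, inclS_projS_add_projV]

theorem iota_apply (ψ : Module.Dual ℂ CylS) (Φ : Cyl) :
    iota h ψ Φ = ψ (projS h (rStar A Φ)) := by
  simp [iota, iotaF, iotaS, dualSum]

theorem rStar_surjective (A : Connection) : Function.Surjective (rStar A) := by
  rintro ⟨_, Φ, hΦ, rfl⟩
  exact ⟨⟨Φ, hΦ⟩, rfl⟩

theorem iota_injective : Function.Injective (iota h) := by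
  intro ψ ψ' heq
  refine LinearMap.ext fun s => ?_
  obtain ⟨Φ, hΦ⟩ := rStar_surjective A (inclS h s)
  have := LinearMap.congr_fun heq Φ
  rwa [iota_apply, iota_apply, hΦ, projS_inclS] at this

/-- The reduced operator is intertwined with the full one by `ι`, because the functions vanishing
at infinity form an ideal of the symmetric cylindrical functions. -/
theorem opFull_dualMap_comp_iota (hV : ∀ f v : CylF A, v ∈ CylV A → f * v ∈ CylV A) (F : Cyl) :
    (opFull F).dualMap ∘ₗ iota h = iota h ∘ₗ (opS h F).dualMap := by
  refine LinearMap.ext fun ψ => LinearMap.ext fun Φ => ?_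
  change iota h ψ (F * Φ) = iota h ((opS h F).dualMap ψ) Φ
  rw [iota_apply, iota_apply]
  change ψ (projS h (rStar A F * rStar A Φ)) =
    ψ (projS h (rStar A F * inclS h (projS h (rStar A Φ))))
  conv_lhs => rw [← inclS_projS_add_projV h (rStar A Φ)]
  rw [mul_add, map_add, projS_of_mem h (hV _ _ (projV h (rStar A Φ)).2), add_zero]

end Projections

end

end LQC

theorem mainTheorem1 (A₀ : LQC.Connection) (hA₀ : A₀ ∈ LQC.symmetricConnections)
    (hne : A₀.comp ≠ 0) :
    ∃ h : LQC.Decomposes A₀,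
      Function.Bijective (LQC.dualSum h) ∧
      Function.Injective (LQC.iota h) ∧
      (∀ (ψ : Module.Dual ℂ LQC.CylS) (Φ : LQC.Cyl),
        LQC.iota h ψ Φ = ψ (LQC.projS h (LQC.rStar A₀ Φ))) ∧
      (∀ F : LQC.Cyl,
        (LQC.opFull F).dualMap ∘ₗ LQC.iota h = LQC.iota h ∘ₗ (LQC.opS h F).dualMap) ∧
      (∀ (γ : ℝ → LQC.Space) (hγ : LQC.IsPiecewiseAnalytic γ) (B C : Fin 2),
        (LQC.opFull (LQC.holonomyElement γ hγ B C)).dualMap ∘ₗ LQC.iota h =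
          LQC.iota h ∘ₗ (LQC.opS h (LQC.holonomyElement γ hγ B C)).dualMap) := by
  obtain ⟨p, hp⟩ := LQC.exists_comp_eq_of_mem_symmetricConnections hA₀
  have hp0 : p ≠ 0 := by
    rintro rfl
    refine hne (funext fun i => funext fun a => funext fun y => ?_)
    rw [hp]
    simp
  have h := LQC.decomposes_of_comp_eq hp0 hp
  have hop := LQC.opFull_dualMap_comp_iota h fun f _ hv => LQC.mul_mem_CylV hp0 hp f hv
  exact ⟨h, LQC.dualSum_bijective h, LQC.iota_injective h, LQC.iota_apply h, hop,
    fun γ hγ B C => hop _⟩
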